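/- Let $n\ge 1$, $0\le k\le n$, $r\ge 0$ be integers. Let $\Omega\subset\mathbb R^n$ be a bounded polyhedral domain with a conforming triangulation $\mathcal T_h$ by $n$-simplices ($\Omega$ is the interior of their union) which is shape-regular with constant $\gamma>0$: every $K\in\mathcal T_h$ contains a ball of radius $h_K/\gamma$, where $h_K=\operatorname{diam}K$; put $h=\max_K h_K$. Write $(\cdot,\cdot)_U$, $\|\cdot\|_U$ for the $L^2$ inner product and norm of differential forms on $U$, $(\cdot,\cdot)_{\mathcal T_h}=\sum_K(\cdot,\cdot)_K$, $\langle\cdot,\cdot\rangle_{\partial K}$ for the $L^2$ inner product on $\partial K$, $\langle\cdot,\cdot\rangle_{\partial\mathcal T_h}=\sum_K\langle\cdot,\cdot\rangle_{\partial K}$, and $$|||\cdot|||_{\partial K}=h_K^{1/2}\|\cdot\|_{\partial K},\qquad |||\cdot|||_{\partial\mathcal T_h}=\Bigl(\sum_K|||\cdot|||_{\partial K}^2\Bigr)^{1/2}.$$ $\tau^{\mathrm{tan}}$ is the pullback of $\tau$ to the facets of $K$; the weak normal trace $v^{\mathrm{nor}}$ of $v\in L^2\Lambda^{j}(K)$ with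 weak codifferential $\delta v\in L^2$ is given by $\langle \tau^{\mathrm{tan}},v^{\mathrm{nor}}\rangle_{\partial K}=(d\tau,v)_K-(\tau,\delta v)_K$. Exact problem: given $f\in L^2\Lambda^k(\Omega)$, let $(\sigma,u,p)\in H\Lambda^{k-1}(\Omega)\times H\Lambda^k(\Omega)\times\mathfrak H^k$ satisfy $(\sigma,\tau)_\Omega-(u,d\tau)_\Omega=0$ for all $\tau\in H\Lambda^{k-1}(\Omega)$, $(d\sigma,v)_\Omega+(du,dv)_\Omega+(p,v)_\Omega=(f,v)_\Omega$ for all $v\in H\Lambda^k(\Omega)$, $(u,q)_\Omega=0$ for all $q\in\mathfrak H^k$, where $\mathfrak H^k$ is the space of closed forms orthogonal to $dH\Lambda^{k-1}(\Omega)$. Put $\rho=du$. Discrete spaces: on each $K$ let $W_h^{k-1}(K)$ be $\mathcal P_{r+1}\Lambda^{k-1}(K)$ or $\mathcal P_{r+1}^-\Lambda^{k-1}(K)$, and $W_h^k(K)$ be $\mathcal P_r\Lambda^k(K)$ (if $r\ge1$) or $\mathcal P_{r+1}^-\Lambda^k(K)$ (the same choices on all $K$), and let $W_h^{k+1}(K)\subset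 H\Lambda^{k+1}(K)$ be any finite-dimensional space containing $dW_h^k(K)$. Let $W_h^j=\prod_KW_h^j(K)$ and, for $j=k-1,k$, $V_h^j=W_h^j\cap H\Lambda^j(\Omega)$, $\widehat W_h^{j,\mathrm{tan}}=\{v_h^{\mathrm{tan}}:v_h\in W_h^j\}\subset L^2\Lambda^j(\partial\mathcal T_h)$, $\widehat V_h^{j,\mathrm{tan}}=\{v_h^{\mathrm{tan}}:v_h\in V_h^j\}$; the dual $\widehat W_h^{j,\mathrm{nor}}$ of $\widehat W_h^{j,\mathrm{tan}}$ is identified with $\widehat W_h^{j,\mathrm{tan}}$ by $\langle\cdot,\cdot\rangle_{\partial\mathcal T_h}$. Let $\mathfrak H_h^k=\{q\in V_h^k:dq=0,\ q\perp dV_h^{k-1}\}$ and let $\overline{\mathfrak H}_h^k$ be the space of $q\in W_h^k$ such that on each $K$: $q^{\mathrm{tan}}=0$, $dq=0$ and $(q,d\tau)_K=0$ for all $\tau\in W_h^{k-1}(K)$ with $\tau^{\mathrm{tan}}=0$. Hybridized method: let $\sigma_h\in W_h^{k-1}$, $u_h\in W_h^k$, $\bar p_h,\bar u_h\in\overline{\mathfrak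 H}_h^k$, $\widehat u_h^{\mathrm{nor}}\in\widehat W_h^{k-1,\mathrm{nor}}$, $\widehat\rho_h^{\mathrm{nor}}\in\widehat W_h^{k,\mathrm{nor}}$, $p_h\in\mathfrak H_h^k$, $\widehat\sigma_h^{\mathrm{tan}}\in\widehat V_h^{k-1,\mathrm{tan}}$, $\widehat u_h^{\mathrm{tan}}\in\widehat V_h^{k,\mathrm{tan}}$ satisfy $$\begin{aligned} (\sigma_h,\tau_h)_{\mathcal T_h}-(u_h,d\tau_h)_{\mathcal T_h}+\langle\widehat u_h^{\mathrm{nor}},\tau_h^{\mathrm{tan}}\rangle_{\partial\mathcal T_h}&=0,\\ (d\sigma_h,v_h)_{\mathcal T_h}+(du_h,dv_h)_{\mathcal T_h}+(\bar p_h+p_h,v_h)_{\mathcal T_h}-\langle\widehat\rho_h^{\mathrm{nor}},v_h^{\mathrm{tan}}\rangle_{\partial\mathcal T_h}&=(f,v_h)_{\mathcal T_h},\\ (\bar u_h-u_h,\bar q_h)_{\mathcal T_h}=0,\quad (u_h,q_h)_{\mathcal T_h}=0,\quad(\bar p_h,\bar v_h)_{\mathcal T_h}&=0,\\ \langle\widehat\sigma_h^{\mathrm{tan}}-\sigma_h^{\mathrm{tan}},\widehat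 v_h^{\mathrm{nor}}\rangle_{\partial\mathcal T_h}=0,\quad\langle\widehat u_h^{\mathrm{tan}}-u_h^{\mathrm{tan}},\widehat\eta_h^{\mathrm{nor}}\rangle_{\partial\mathcal T_h}&=0,\\ \langle\widehat u_h^{\mathrm{nor}},\widehat\tau_h^{\mathrm{tan}}\rangle_{\partial\mathcal T_h}=0,\quad\langle\widehat\rho_h^{\mathrm{nor}},\widehat v_h^{\mathrm{tan}}\rangle_{\partial\mathcal T_h}&=0 \end{aligned}$$ for all $\tau_h\in W_h^{k-1}$, $v_h\in W_h^k$, $\bar q_h,\bar v_h\in\overline{\mathfrak H}_h^k$, $q_h\in\mathfrak H_h^k$, $\widehat v_h^{\mathrm{nor}}\in\widehat W_h^{k-1,\mathrm{nor}}$, $\widehat\eta_h^{\mathrm{nor}}\in\widehat W_h^{k,\mathrm{nor}}$, $\widehat\tau_h^{\mathrm{tan}}\in\widehat V_h^{k-1,\mathrm{tan}}$, $\widehat v_h^{\mathrm{tan}}\in\widehat V_h^{k,\mathrm{tan}}$. Let $\widehat P_hu^{\mathrm{nor}}\in\widehat W_h^{k-1,\mathrm{nor}}$ and $\widehat P_h\rho^{\mathrm{nor}}\in\widehat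 W_h^{k,\mathrm{nor}}$ have the same pairings as $u^{\mathrm{nor}}$ and $\rho^{\mathrm{nor}}$ with all elements of $\widehat W_h^{k-1,\mathrm{tan}}$ and $\widehat W_h^{k,\mathrm{tan}}$, respectively, and let $P_h$ be the $L^2$ projection onto $W_h^k$ (for $u$) and onto $W_h^{k+1}$ (for $d(u-u_h)$). Then there is a constant $C$, depending only on $n,k,r,\gamma$ and the choice of the element families, such that for each $K\in\mathcal T_h$ $$|||\widehat P_hu^{\mathrm{nor}}-\widehat u_h^{\mathrm{nor}}|||_{\partial K}\le C\bigl(\|P_hu-u_h\|_K+h_K\|\sigma-\sigma_h\|_K\bigr),$$ $$|||\widehat P_h\rho^{\mathrm{nor}}-\widehat\rho_h^{\mathrm{nor}}|||_{\partial K}\le C\bigl(\|P_hd(u-u_h)\|_K+h_K(\|d(\sigma-\sigma_h)\|_K+\|p-p_h\|_K)\bigr),$$ and consequently $$|||\widehat P_hu^{\mathrm{nor}}-\widehat u_h^{\mathrm{nor}}|||_{\partial\mathcal T_h}\le C\bigl(\|P_hu-u_h\|_{\mathcal T_h}+h\|\sigma-\sigma_h\|_\Omega\bigr),$$ $$|||\widehat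 P_h\rho^{\mathrm{nor}}-\widehat\rho_h^{\mathrm{nor}}|||_{\partial\mathcal T_h}\le C\bigl(\|P_hd(u-u_h)\|_{\mathcal T_h}+h(\|d(\sigma-\sigma_h)\|_\Omega+\|p-p_h\|_\Omega)\bigr).$$ -/

import Mathlib

open MeasureTheory
open scoped ContDiff

noncomputable section

namespace HybridFEEC

/-! ### Exterior algebra -/

/-- Alternating forms, with the degree shifted by one so that degree `-1` is available:
`Alt V 0 = 0` is the (trivial) space of `(-1)`-forms and `Alt V (k + 1)` is the space of
alternating `k`-linear forms on `V`. -/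
def Alt (V : Type) [NormedAddCommGroup V] [NormedSpace ℝ V] : ℕ → Type
  | 0 => PUnit
  | k + 1 => V [⋀^Fin k]→L[ℝ] ℝ

section

variable {V W : Type} [NormedAddCommGroup V] [NormedSpace ℝ V]
  [NormedAddCommGroup W] [NormedSpace ℝ W]

instance instNormedAddCommGroupAlt : ∀ j : ℕ, NormedAddCommGroup (Alt V j)
  | 0 => inferInstanceAs (NormedAddCommGroup PUnit)
  | k + 1 => inferInstanceAs (NormedAddCommGroup (V [⋀^Fin k]→L[ℝ] ℝ))

instance instNormedSpaceAlt : ∀ j : ℕ, NormedSpace ℝ (Alt V j)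
  | 0 => inferInstanceAs (NormedSpace ℝ PUnit)
  | k + 1 => inferInstanceAs (NormedSpace ℝ (V [⋀^Fin k]→L[ℝ] ℝ))

instance instAddCommGroupAlt (j : ℕ) : AddCommGroup (Alt V j) :=
  (instNormedAddCommGroupAlt j).toAddCommGroup

instance instModuleAlt (j : ℕ) : Module ℝ (Alt V j) :=
  (instNormedSpaceAlt j).toModule

/-- The inner product on alternating `k`-forms in terms of an orthonormal basis `b` of `V`.
Summing over all index maps `Fin k → ι` and dividing by `k!` is the same as summing over the
increasing multi-indices, since the summand is symmetric and vanishes on non-injective maps. -/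
def altInner {ι : Type} [Fintype ι] (b : ι → V) : ∀ j : ℕ, Alt V j → Alt V j → ℝ
  | 0, _, _ => 0
  | k + 1, α, β =>
      let α' : V [⋀^Fin k]→L[ℝ] ℝ := α
      let β' : V [⋀^Fin k]→L[ℝ] ℝ := β
      ((k.factorial : ℝ))⁻¹ * ∑ I : Fin k → ι, α' (fun i => b (I i)) * β' (fun i => b (I i))

/-- The interior product `ι_v α`; it vanishes on `0`-forms. -/
def contract (v : V) : ∀ j : ℕ, Alt V (j + 1) →ₗ[ℝ] Alt V j
  | 0 => 0
  | k + 1 =>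
      { toFun := fun α =>
          (ContinuousAlternatingMap.curryLeft (show V [⋀^Fin (k + 1)]→L[ℝ] ℝ from α) v :
            V [⋀^Fin k]→L[ℝ] ℝ)
        map_add' := fun _ _ => rfl
        map_smul' := fun _ _ => rfl }

/-- The pullback `A^* α` of an alternating form by a linear map. -/
def pullback (A : V →L[ℝ] W) : ∀ j : ℕ, Alt W j →ₗ[ℝ] Alt V j
  | 0 => 0
  | k + 1 =>
      { toFun := fun α =>
          (ContinuousAlternatingMap.compContinuousLinearMap
            (show W [⋀^Fin k]→L[ℝ] ℝ from α) A : V [⋀^Fin k]→L[ℝ] ℝ)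
        map_add' := fun _ _ => rfl
        map_smul' := fun _ _ => rfl }

end

/-! ### Differential forms on subsets of Euclidean space -/

/-- `n`-dimensional Euclidean space. -/
abbrev Euc (n : ℕ) : Type := EuclideanSpace ℝ (Fin n)

/-- Differential forms on `ℝⁿ` (no regularity): `Form n 0` are the `(-1)`-forms (zero), and
`Form n (k + 1)` are the `k`-forms. -/
abbrev Form (n j : ℕ) : Type := Euc n → Alt (Euc n) j

variable {n : ℕ}

/-- The exterior derivative of a differentiable form. -/
def extD : ∀ j : ℕ, Form n j → Form n (j + 1)
  | 0, _ => 0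
  | k + 1, α => extDeriv (show Euc n → Euc n [⋀^Fin k]→L[ℝ] ℝ from α)

/-- The codifferential `δ η = - ∑ i, ι_{e_i} (∂_i η)` of a differentiable form on `ℝⁿ`
(the coordinate expression of `(-1)^k ⋆⁻¹ d ⋆` on `k`-forms). -/
def codiff (j : ℕ) (η : Form n (j + 1)) : Form n j := fun x =>
  - ∑ i : Fin n, contract (EuclideanSpace.single i (1 : ℝ)) j
      (fderiv ℝ η x (EuclideanSpace.single i (1 : ℝ)))

/-- The `L²` inner product `(α, β)_U`. -/
def ip {j : ℕ} (U : Set (Euc n)) (α β : Form n j) : ℝ :=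
  ∫ x in U, altInner (fun i : Fin n => EuclideanSpace.single i (1 : ℝ)) j (α x) (β x)

/-- The `L²` norm `‖α‖_U`. -/
def nrm {j : ℕ} (U : Set (Euc n)) (α : Form n j) : ℝ := √(ip U α α)

/-- `α ∈ L² Λ(U)`. -/
def MemL2 {j : ℕ} (U : Set (Euc n)) (α : Form n j) : Prop := MemLp α 2 (volume.restrict U)

/-- Smooth forms with compact support in the open set `U`. -/
def IsTest {j : ℕ} (U : Set (Euc n)) (η : Form n j) : Prop :=
  ContDiff ℝ ∞ η ∧ HasCompactSupport η ∧ tsupport η ⊆ U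

/-- `v ∈ H Λ(U)` with weak exterior derivative `w`. -/
def IsWeakD {j : ℕ} (U : Set (Euc n)) (v : Form n j) (w : Form n (j + 1)) : Prop :=
  MemL2 U v ∧ MemL2 U w ∧ ∀ η : Form n (j + 1), IsTest U η → ip U w η = ip U v (codiff j η)

/-- `v ∈ H^* Λ(U)` with weak codifferential `w`. -/
def IsWeakCodiff {j : ℕ} (U : Set (Euc n)) (v : Form n (j + 1)) (w : Form n j) : Prop :=
  MemL2 U v ∧ MemL2 U w ∧ ∀ τ : Form n j, IsTest U τ → ip U τ w = ip U (extD j τ) v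

/-- Harmonic forms on `Ω` (natural boundary conditions): closed and orthogonal to all exact
forms. -/
def IsHarmonic {j : ℕ} (Ω : Set (Euc n)) (p : Form n (j + 1)) : Prop :=
  IsWeakD Ω p 0 ∧ ∀ (τ : Form n j) (dτ : Form n (j + 1)), IsWeakD Ω τ dτ → ip Ω p dτ = 0

/-- `(σ, u, p)` solves the mixed formulation of the Hodge--Laplace problem with right-hand side
`f`; `dσ` and `du` are the weak exterior derivatives of `σ` and `u`. If `u` is a `k`-form, then
`j = k`. -/
structure HodgeLaplaceSolution {j : ℕ} (Ω : Set (Euc n)) (f : Form n (j + 1))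
    (σ : Form n j) (dσ u : Form n (j + 1)) (du : Form n (j + 2)) (p : Form n (j + 1)) :
    Prop where
  sigma_mem : IsWeakD Ω σ dσ
  u_mem : IsWeakD Ω u du
  p_mem : IsHarmonic Ω p
  eq_tau : ∀ (τ : Form n j) (dτ : Form n (j + 1)), IsWeakD Ω τ dτ → ip Ω σ τ - ip Ω u dτ = 0
  eq_v : ∀ (v : Form n (j + 1)) (dv : Form n (j + 2)), IsWeakD Ω v dv →
    ip Ω dσ v + ip Ω du dv + ip Ω p v = ip Ω f v
  eq_q : ∀ q : Form n (j + 1), IsHarmonic Ω q → ip Ω u q = 0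

/-! ### Simplicial meshes -/

/-- The closed simplex with vertex set `K`. -/
def cell (K : Finset (Euc n)) : Set (Euc n) := convexHull ℝ (K : Set (Euc n))

/-- The facet of the simplex `K` opposite to the vertex `v`. -/
def facet (K : Finset (Euc n)) (v : {v // v ∈ K}) : Set (Euc n) :=
  convexHull ℝ ((K : Set (Euc n)) \ {v.1})

/-- The tangent space of the facet of `K` opposite to `v`. -/
def facetDir (K : Finset (Euc n)) (v : {v // v ∈ K}) : Submodule ℝ (Euc n) :=
  vectorSpan ℝ ((K : Set (Euc n)) \ {v.1})

/-- `h_K`, the diameter of the simplex `K`. -/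
def cellDiam (K : Finset (Euc n)) : ℝ := Metric.diam (cell K)

/-- `h`, the largest diameter of a simplex of the mesh `T`. -/
def meshSize (T : Finset (Finset (Euc n))) : ℝ := ⨆ K : {K // K ∈ T}, cellDiam K.1

/-- The finite set `T` of `n`-simplices (given by their vertex sets) is a conforming
triangulation of the polyhedral domain `Ω`: its members are the maximal faces of a simplicial
complex, and `Ω` is the interior of their union. -/
structure IsTriangulation (Ω : Set (Euc n)) (T : Finset (Finset (Euc n))) : Prop where
  exists_complex : ∃ 𝒦 : Geometry.SimplicialComplex ℝ (Euc n),
    𝒦.facets = (T : Set (Finset (Euc n))) ∧ Ω = interior 𝒦.space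
  card_eq : ∀ K ∈ T, K.card = n + 1

/-- Shape regularity with constant `γ`: each simplex `K` contains a ball of radius `h_K / γ`. -/
def ShapeRegular (γ : ℝ) (T : Finset (Finset (Euc n))) : Prop :=
  ∀ K ∈ T, ∃ c : Euc n, Metric.ball c (cellDiam K / γ) ⊆ cell K

/-! ### Broken forms

A broken form assigns to each simplex `K` of the mesh a form on `K`; its values on index sets
which are not in the mesh are irrelevant. -/

/-- Broken differential forms. -/
abbrev Broken (n j : ℕ) : Type := Finset (Euc n) → Form n j

/-- The broken inner product `(α, β)_{𝒯_h}`. -/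
def bip {j : ℕ} (T : Finset (Finset (Euc n))) (α β : Broken n j) : ℝ :=
  ∑ K ∈ T, ip (cell K) (α K) (β K)

/-- The broken norm `‖α‖_{𝒯_h}`. For `α` in `L² Λ(Ω)`, restricted to the simplices of a
triangulation of `Ω`, this is the same as `‖α‖_Ω`. -/
def bnrm {j : ℕ} (T : Finset (Finset (Euc n))) (α : Broken n j) : ℝ := √(bip T α α)

/-- The broken form `w` is (the restriction of) an element of `H Λ(Ω)`. -/
def IsUnbroken {j : ℕ} (Ω : Set (Euc n)) (T : Finset (Finset (Euc n))) (w : Broken n j) :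
    Prop :=
  ∃ (v : Form n j) (dv : Form n (j + 1)), IsWeakD Ω v dv ∧
    ∀ K ∈ T, v =ᵐ[volume.restrict (cell K)] w K

/-! ### Tangential and normal traces on the boundary of a simplex -/

/-- Fields of alternating forms on the tangent spaces of the facets of `K`. -/
abbrev TanField (K : Finset (Euc n)) (j : ℕ) : Type :=
  (v : {v // v ∈ K}) → Euc n → Alt (facetDir K v) j

instance instAddCommGroupTanField (K : Finset (Euc n)) (j : ℕ) : AddCommGroup (TanField K j) :=
  Pi.addCommGroup

instance instModuleTanField (K : Finset (Euc n)) (j : ℕ) : Module ℝ (TanField K j) :=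
  Pi.module _ _ _

open Classical in
/-- The tangential trace on `∂K`: on each facet, the pullback by the inclusion of the facet
(extended by zero off the facet). -/
def tanTrace (K : Finset (Euc n)) (j : ℕ) : Form n j →ₗ[ℝ] TanField K j :=
  LinearMap.pi fun v => LinearMap.pi fun x =>
    if x ∈ facet K v then
      (pullback (facetDir K v).subtypeL j).comp (LinearMap.proj x)
    else 0

/-- The `L²` inner product `⟨s, t⟩_{∂K}` with respect to surface measure. -/
def bdIp {j : ℕ} (K : Finset (Euc n)) (s t : TanField K j) : ℝ :=
  ∑ v : {v // v ∈ K}, ∫ x in facet K v,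
    altInner (stdOrthonormalBasis ℝ (facetDir K v)) j (s v x) (t v x)
      ∂(Measure.euclideanHausdorffMeasure (n - 1) : Measure (Euc n))

/-- The scaled norm `|||s|||_{∂K} = h_K^{1/2} ‖s‖_{∂K}`. -/
def triNorm {j : ℕ} (K : Finset (Euc n)) (s : TanField K j) : ℝ :=
  √(cellDiam K) * √(bdIp K s s)

/-- Broken boundary fields, double valued on the interfaces. -/
abbrev BrokenTan (n j : ℕ) : Type := (K : Finset (Euc n)) → TanField K j

/-- The pairing `⟨s, t⟩_{∂𝒯_h}`. -/
def bbdIp {j : ℕ} (T : Finset (Finset (Euc n))) (s t : BrokenTan n j) : ℝ :=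
  ∑ K ∈ T, bdIp K (s K) (t K)

/-- The scaled norm `|||s|||_{∂𝒯_h} = (∑_K |||s|||_{∂K}²)^{1/2}`. -/
def bTriNorm {j : ℕ} (T : Finset (Finset (Euc n))) (s : BrokenTan n j) : ℝ :=
  √(∑ K ∈ T, triNorm K (s K) ^ 2)

/-- The pairing `⟨τ^tan, v^nor⟩_{∂K} = (dτ, v)_K - (τ, δv)_K` of the tangential trace of
`τ ∈ H Λ(K)` with the weak normal trace of `v ∈ H^* Λ(K)`. -/
def traceDuality {j : ℕ} (K : Finset (Euc n)) (τ : Form n j) (dτ : Form n (j + 1))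
    (v : Form n (j + 1)) (δv : Form n j) : ℝ :=
  ip (cell K) dτ v - ip (cell K) τ δv

/-! ### Polynomial differential forms -/

/-- Real polynomial functions on `ℝⁿ` of degree at most `r`. -/
def IsPoly (r : ℕ) (g : Euc n → ℝ) : Prop :=
  ∃ P : MvPolynomial (Fin n) ℝ, P.totalDegree ≤ r ∧ ∀ x, g x = MvPolynomial.eval (fun i => x i) P

/-- `𝒫_r Λ`: forms all of whose coefficients (equivalently, all of whose compositions with
linear functionals on alternating forms) are polynomials of degree at most `r`. -/
def polyForms (n r j : ℕ) : Submodule ℝ (Form n j) where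
  carrier := {v | ∀ ℓ : Alt (Euc n) j →ₗ[ℝ] ℝ, IsPoly r fun x => ℓ (v x)}
  zero_mem' := fun ℓ => ⟨0, by simp, by simp⟩
  add_mem' := by
    intro v w hv hw ℓ
    obtain ⟨P, hP, hP'⟩ := hv ℓ
    obtain ⟨Q, hQ, hQ'⟩ := hw ℓ
    exact ⟨P + Q, (MvPolynomial.totalDegree_add P Q).trans (max_le hP hQ),
      fun x => by simp [hP' x, hQ' x]⟩
  smul_mem' := by
    intro c v hv ℓ
    obtain ⟨P, hP, hP'⟩ := hv ℓ
    exact ⟨c • P, (MvPolynomial.totalDegree_smul_le c P).trans hP,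
      fun x => by simp [hP' x]⟩

/-- The Koszul differential: contraction with the vector field `x`. -/
def koszul (n j : ℕ) : Form n (j + 1) →ₗ[ℝ] Form n j :=
  LinearMap.pi fun x => (contract x j).comp (LinearMap.proj x)

/-- `𝒫_{r+1}^- Λ = 𝒫_r Λ + κ 𝒫_r Λ`. (The index is shifted: `r` here gives `𝒫_{r+1}^-`.) -/
def trimmedForms (n r j : ℕ) : Submodule ℝ (Form n j) :=
  polyForms n r j ⊔ (polyForms n r (j + 1)).map (koszul n j)

/-- The two families `𝒫` and `𝒫^-` of polynomial forms. -/
inductive Kind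
  | full
  | trimmed

/-- The local space of `(k-1)`-forms in a stable pair: `𝒫_{r+1} Λ` or `𝒫_{r+1}^- Λ`. -/
def lowSpace (n r : ℕ) (j : ℕ) : Kind → Submodule ℝ (Form n j)
  | .full => polyForms n (r + 1) j
  | .trimmed => trimmedForms n r j

/-- The local space of `k`-forms in a stable pair: `𝒫_r Λ` (only used if `r ≥ 1`) or
`𝒫_{r+1}^- Λ`. -/
def highSpace (n r : ℕ) (j : ℕ) : Kind → Submodule ℝ (Form n j)
  | .full => polyForms n r j
  | .trimmed => trimmedForms n r j

/-! ### Discrete spaces and the hybridized method -/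

/-- `w ∈ W_h`, where each local space is `S`. -/
def MemW {j : ℕ} (T : Finset (Finset (Euc n))) (S : Submodule ℝ (Form n j)) (w : Broken n j) :
    Prop :=
  ∀ K ∈ T, w K ∈ S

/-- `w ∈ V_h = H Λ(Ω) ∩ W_h`. -/
def MemV {j : ℕ} (Ω : Set (Euc n)) (T : Finset (Finset (Euc n))) (S : Submodule ℝ (Form n j))
    (w : Broken n j) : Prop :=
  MemW T S w ∧ IsUnbroken Ω T w

/-- The space of tangential traces on `∂K` of local forms in `S`. -/
def tanSpace {j : ℕ} (K : Finset (Euc n)) (S : Submodule ℝ (Form n j)) :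
    Submodule ℝ (TanField K j) :=
  S.map (tanTrace K j)

/-- `s` is an element of the broken trace space `Ŵ_h^tan`. It is also used for its dual space
`Ŵ_h^nor`, the duality pairing being the `L²` inner product on `∂𝒯_h`. -/
def MemWhat {j : ℕ} (T : Finset (Finset (Euc n))) (S : Submodule ℝ (Form n j))
    (s : BrokenTan n j) : Prop :=
  ∀ K ∈ T, s K ∈ tanSpace K S

/-- `s` is an element of the single-valued trace space `V̂_h^tan = {v_h^tan : v_h ∈ V_h}`. -/
def MemVhat {j : ℕ} (Ω : Set (Euc n)) (T : Finset (Finset (Euc n)))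
    (S : Submodule ℝ (Form n j)) (s : BrokenTan n j) : Prop :=
  ∃ w : Broken n j, MemV Ω T S w ∧ ∀ K ∈ T, s K = tanTrace K j (w K)

/-- Elementwise exterior derivative of a piecewise smooth broken form. -/
def bD {j : ℕ} (w : Broken n j) : Broken n (j + 1) := fun K => extD j (w K)

/-- Elementwise tangential trace. -/
def bTan {j : ℕ} (w : Broken n j) : BrokenTan n j := fun K => tanTrace K j (w K)

/-- Global discrete harmonic forms: elements of `V_h` that are closed and orthogonal to
`d V_h`. Here `S₀` and `S₁` are the local spaces of `(k-1)`- and `k`-forms. -/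
def IsDiscreteHarmonic {j : ℕ} (Ω : Set (Euc n)) (T : Finset (Finset (Euc n)))
    (S₀ : Submodule ℝ (Form n j)) (S₁ : Submodule ℝ (Form n (j + 1))) (p : Broken n (j + 1)) :
    Prop :=
  MemV Ω T S₁ p ∧ (∀ K ∈ T, ∀ x ∈ cell K, extD (j + 1) (p K) x = 0) ∧
    ∀ τ : Broken n j, MemV Ω T S₀ τ → bip T p (bD τ) = 0

/-- Local discrete harmonic forms with vanishing tangential trace, on each simplex. -/
def IsLocalHarmonic {j : ℕ} (T : Finset (Finset (Euc n)))
    (S₀ : Submodule ℝ (Form n j)) (S₁ : Submodule ℝ (Form n (j + 1))) (q : Broken n (j + 1)) :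
    Prop :=
  ∀ K ∈ T, q K ∈ S₁ ∧ tanTrace K (j + 1) (q K) = 0 ∧
    (∀ x ∈ cell K, extD (j + 1) (q K) x = 0) ∧
    ∀ τ ∈ S₀, tanTrace K j τ = 0 → ip (cell K) (q K) (extD j τ) = 0

/-- The hybridized finite element method for the Hodge--Laplace problem on `k`-forms (`j = k`),
with local spaces `S₀` of `(k-1)`-forms and `S₁` of `k`-forms. The unknowns are
`σ_h`, `u_h`, `p̄_h`, `û_h^nor`, `ρ̂_h^nor` (local variables) and
`p_h`, `ū_h`, `σ̂_h^tan`, `û_h^tan` (global variables). -/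
structure HybridSolution {j : ℕ} (Ω : Set (Euc n)) (T : Finset (Finset (Euc n)))
    (S₀ : Submodule ℝ (Form n j)) (S₁ : Submodule ℝ (Form n (j + 1))) (f : Form n (j + 1))
    (σh : Broken n j) (uh pbar : Broken n (j + 1))
    (unor : BrokenTan n j) (rhonor : BrokenTan n (j + 1))
    (ph ubar : Broken n (j + 1)) (σtan : BrokenTan n j) (utan : BrokenTan n (j + 1)) :
    Prop where
  sigma_mem : MemW T S₀ σh
  u_mem : MemW T S₁ uh
  pbar_mem : IsLocalHarmonic T S₀ S₁ pbar
  unor_mem : MemWhat T S₀ unor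
  rhonor_mem : MemWhat T S₁ rhonor
  p_mem : IsDiscreteHarmonic Ω T S₀ S₁ ph
  ubar_mem : IsLocalHarmonic T S₀ S₁ ubar
  sigmatan_mem : MemVhat Ω T S₀ σtan
  utan_mem : MemVhat Ω T S₁ utan
  eq_tau : ∀ τ : Broken n j, MemW T S₀ τ →
    bip T σh τ - bip T uh (bD τ) + bbdIp T unor (bTan τ) = 0
  eq_v : ∀ v : Broken n (j + 1), MemW T S₁ v →
    bip T (bD σh) v + bip T (bD uh) (bD v) + bip T (pbar + ph) v - bbdIp T rhonor (bTan v)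
      = bip T (fun _ => f) v
  eq_qbar : ∀ q : Broken n (j + 1), IsLocalHarmonic T S₀ S₁ q → bip T (ubar - uh) q = 0
  eq_vnor : ∀ s : BrokenTan n j, MemWhat T S₀ s → bbdIp T (σtan - bTan σh) s = 0
  eq_etanor : ∀ s : BrokenTan n (j + 1), MemWhat T S₁ s → bbdIp T (utan - bTan uh) s = 0
  eq_q : ∀ q : Broken n (j + 1), IsDiscreteHarmonic Ω T S₀ S₁ q → bip T uh q = 0
  eq_vbar : ∀ v : Broken n (j + 1), IsLocalHarmonic T S₀ S₁ v → bip T pbar v = 0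
  eq_tautan : ∀ s : BrokenTan n j, MemVhat Ω T S₀ s → bbdIp T unor s = 0
  eq_vtan : ∀ s : BrokenTan n (j + 1), MemVhat Ω T S₁ s → bbdIp T rhonor s = 0

/-- `Pv = P̂_h v^nor`: the element of `Ŵ_h^nor` (identified with `Ŵ_h^tan` by the `L²` inner
product) that has the same pairing with all discrete tangential traces as the weak normal trace
of `v`. The form `v` is required to be in `H^* Λ(K)` for all simplices `K`. -/
def IsNormalTraceProj {j : ℕ} (T : Finset (Finset (Euc n))) (S : Submodule ℝ (Form n j))
    (v : Form n (j + 1)) (Pv : BrokenTan n j) : Prop :=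
  MemWhat T S Pv ∧ ∃ δv : Broken n j,
    (∀ K ∈ T, IsWeakCodiff (interior (cell K)) v (δv K)) ∧
    ∀ τ : Broken n j, MemW T S τ →
      bbdIp T Pv (bTan τ) = ∑ K ∈ T, traceDuality K (τ K) (extD j (τ K)) v (δv K)

/-- `Pw = P_h w`: elementwise `L²` projection of `w` onto the broken space whose local spaces
are `S K`. -/
def IsL2Proj {j : ℕ} (T : Finset (Finset (Euc n)))
    (S : Finset (Euc n) → Submodule ℝ (Form n j)) (w Pw : Broken n j) : Prop :=
  ∀ K ∈ T, Pw K ∈ S K ∧ ∀ s ∈ S K, ip (cell K) (w K - Pw K) s = 0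

/-- `S₂` is a possible choice of local spaces of `(k+1)`-forms on the simplices, continuing the
complex after the local space `S₁` of `k`-forms: each `S₂ K` is a finite-dimensional subspace of
`H Λ(K)` that contains `d S₁`. -/
def ContinuesComplex {j : ℕ} (T : Finset (Finset (Euc n))) (S₁ : Submodule ℝ (Form n j))
    (S₂ : Finset (Euc n) → Submodule ℝ (Form n (j + 1))) : Prop :=
  ∀ K ∈ T, Module.Finite ℝ (S₂ K) ∧ (∀ v ∈ S₁, extD j v ∈ S₂ K) ∧
    ∀ w ∈ S₂ K, ∃ dw, IsWeakD (interior (cell K)) w dw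

end HybridFEEC

end

open HybridFEEC

/-! Both local estimates are duality arguments. The error e of a normal trace lies in the discrete
tangential trace space of K, so it is the trace of a discrete form τ, and τ can be chosen with ‖τ‖_K
and h_K‖dτ‖_K both at most C|||e||| (`exists_uniform_lift`). Since |||e|||² = h_K⟨e, τ^tan⟩, a bound
of the pairing by ‖dτ‖E + ‖τ‖G for all discrete τ yields |||e||| ≤ C(E + h_K G)
(`triNorm_le_of_pairing`).

The pairings come from subtracting discrete from exact equations on one simplex. Testing the exact
problem with smooth forms supported inside K gives δu = σ and δρ = f - dσ - p there. Hence ⟨e,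
τ^tan⟩ = (P_h u - u_h, dτ)_K - (σ - σ_h, τ)_K for u, where the projection enters because dτ lies in
W_h^k (`pairing_unor_le`). For ρ the pairing with v^tan is (P_h d(u - u_h), dv)_K + (d(σ - σ_h) + p
- p_h, v)_K; the term p̄_h drops out because it is orthogonal to itself (`pairing_rhonor_le`).

The lifting is built on one reference simplex, by restricting to a complement of the trace-free
forms in a finite-dimensional space (`exists_lift_bound`). Affine pullback preserves the local
spaces and commutes with d and with tangential traces, so the lifting transports to every K. Shape
regularity bounds the affine map by a multiple of h_K and its inverse by a multiple of 1/h_K, and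
the powers of h_K combine to the weight in |||·|||. The global estimates follow by summing squares.
-/

noncomputable section

namespace HybridFEEC

/-! ### Pointwise inner products and pullbacks of alternating forms. -/

section Algebra

variable {V W : Type} [NormedAddCommGroup V] [InnerProductSpace ℝ V]
  [NormedAddCommGroup W] [InnerProductSpace ℝ W]

/-- The continuous alternating map underlying an element of `Alt V (k + 1)`. -/
abbrev Alt.form {k : ℕ} (α : Alt V (k + 1)) : V [⋀^Fin k]→L[ℝ] ℝ := α

theorem altInner_add_left {ι : Type} [Fintype ι] (b : ι → V) :
    ∀ (j : ℕ) (α β ξ : Alt V j), altInner b j (α + β) ξ = altInner b j α ξ + altInner b j β ξ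
  | 0, _, _, _ => by simp [altInner]
  | k + 1, α, β, ξ => by
      change (k.factorial : ℝ)⁻¹ * ∑ I : Fin k → ι,
        (α.form (fun i => b (I i)) + β.form (fun i => b (I i))) * _ = _
      simp only [add_mul, Finset.sum_add_distrib, mul_add]
      rfl

theorem altInner_smul_left {ι : Type} [Fintype ι] (b : ι → V) :
    ∀ (j : ℕ) (c : ℝ) (α β : Alt V j), altInner b j (c • α) β = c * altInner b j α β
  | 0, _, _, _ => by simp [altInner]
  | k + 1, c, α, β => by
      change (k.factorial : ℝ)⁻¹ * ∑ I : Fin k → ι,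
        (c * α.form (fun i => b (I i))) * _ = c * (_ * _)
      rw [mul_left_comm]
      simp only [mul_assoc, Finset.mul_sum]

theorem altInner_comm {ι : Type} [Fintype ι] (b : ι → V) :
    ∀ (j : ℕ) (α β : Alt V j), altInner b j α β = altInner b j β α
  | 0, _, _ => rfl
  | k + 1, α, β => by
      simp only [altInner, mul_comm]

theorem altInner_self_nonneg {ι : Type} [Fintype ι] (b : ι → V) :
    ∀ (j : ℕ) (α : Alt V j), 0 ≤ altInner b j α α
  | 0, _ => le_rfl
  | k + 1, α => by
      simp only [altInner]
      exact mul_nonneg (by positivity) (Finset.sum_nonneg fun I _ => mul_self_nonneg _)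

/-- `altInner` as a bilinear map. -/
def altBilin {ι : Type} [Fintype ι] (b : ι → V) (j : ℕ) : Alt V j →ₗ[ℝ] Alt V j →ₗ[ℝ] ℝ :=
  LinearMap.mk₂ ℝ (altInner b j) (altInner_add_left b j) (altInner_smul_left b j)
    (fun α β ξ => by
      rw [altInner_comm, altInner_add_left, altInner_comm b j β, altInner_comm b j ξ])
    (fun c α β => by rw [altInner_comm, altInner_smul_left, altInner_comm b j β]; rfl)

theorem altBilin_apply {ι : Type} [Fintype ι] (b : ι → V) (j : ℕ) (α β : Alt V j) :
    altBilin b j α β = altInner b j α β := rfl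

@[simp] theorem altInner_zero_left {ι : Type} [Fintype ι] (b : ι → V) (j : ℕ) (β : Alt V j) :
    altInner b j 0 β = 0 := by simp [← altBilin_apply]

@[simp] theorem altInner_zero_right {ι : Type} [Fintype ι] (b : ι → V) (j : ℕ) (β : Alt V j) :
    altInner b j β 0 = 0 := by simp [← altBilin_apply]

/-- Evaluation of an alternating form is controlled by its Euclidean norm. -/
theorem sq_apply_le_prod_mul_sum {ι : Type} [Fintype ι] [DecidableEq ι]
    (b : OrthonormalBasis ι ℝ V) {k : ℕ} (α : V [⋀^Fin k]→L[ℝ] ℝ) (v : Fin k → V) :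
    α v ^ 2 ≤ (∏ i, ‖v i‖ ^ 2) * ∑ I : Fin k → ι, α (fun i => b (I i)) ^ 2 := by
  have hv : α v = ∑ I : Fin k → ι, (∏ i, inner ℝ (b (I i)) (v i)) * α (fun i => b (I i)) := by
    have h1 : v = fun i => ∑ l, inner ℝ (b l) (v i) • b l := by
      funext i; exact (b.sum_repr' (v i)).symm
    conv_lhs => rw [h1]
    have := α.toMultilinearMap.map_sum (fun (i : Fin k) (l : ι) => inner ℝ (b l) (v i) • b l)
    refine this.trans (Finset.sum_congr rfl fun I _ => ?_)
    exact α.toMultilinearMap.map_smul_univ (fun i => inner ℝ (b (I i)) (v i)) (fun i => b (I i))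
  -- By Parseval the product of squared norms is the sum of the squared coefficient products in the
  -- expansion of α v, so Cauchy–Schwarz over the index maps I finishes.
  have hn : (∏ i, ‖v i‖ ^ 2) = ∑ I : Fin k → ι, (∏ i, inner ℝ (b (I i)) (v i)) ^ 2 := by
    have h2 : ∀ i, ‖v i‖ ^ 2 = ∑ l, (inner ℝ (b l) (v i)) ^ 2 := fun i => by
      rw [← b.sum_sq_norm_inner_right (v i)]
      simp
    simp_rw [h2, Finset.prod_univ_sum, Finset.prod_pow]
    simp
  rw [hv, hn]
  exact Finset.sum_mul_sq_le_sq_mul_sq _ _ _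

theorem sq_apply_le_altInner {ι : Type} [Fintype ι] (b : OrthonormalBasis ι ℝ V) {k : ℕ}
    (α : V [⋀^Fin k]→L[ℝ] ℝ) (v : Fin k → V) :
    α v ^ 2 ≤ (∏ i, ‖v i‖ ^ 2) * (k.factorial * altInner b (k + 1) α α) := by
  classical
  refine (sq_apply_le_prod_mul_sum b α v).trans_eq ?_
  simp only [altInner]
  rw [mul_inv_cancel_left₀ (by positivity)]
  simp only [sq]

theorem eq_zero_of_altInner_self {ι : Type} [Fintype ι] (b : OrthonormalBasis ι ℝ V) :
    ∀ (j : ℕ) (α : Alt V j), altInner b j α α = 0 → α = 0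
  | 0, _, _ => rfl
  | k + 1, α, h => by
      refine ContinuousAlternatingMap.ext fun v => ?_
      have := sq_apply_le_altInner b α v
      rw [h, mul_zero, mul_zero] at this
      exact pow_eq_zero_iff two_ne_zero |>.1 (le_antisymm this (sq_nonneg _))

/-- Each component of the pullback evaluates α at vectors of length at most ‖A‖. The factor
`Fintype.card κ ^ k` counts components and k! cancels; a sharp constant is not needed. -/
theorem altInner_pullback_le {ι κ : Type} [Fintype ι] [Fintype κ] (b : OrthonormalBasis ι ℝ V)
    (c : OrthonormalBasis κ ℝ W) (A : W →L[ℝ] V) (k : ℕ) (α : Alt V (k + 1)) :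
    altInner c (k + 1) (pullback A (k + 1) α) (pullback A (k + 1) α) ≤
      Fintype.card κ ^ k * (‖A‖ ^ 2) ^ k * altInner b (k + 1) α α := by
  have h0 := altInner_self_nonneg b (k + 1) α
  have key : ∀ I : Fin k → κ, α.form (fun i => A (c (I i))) ^ 2 ≤
      (‖A‖ ^ 2) ^ k * (k.factorial * altInner b (k + 1) α α) := fun I => by
    refine (sq_apply_le_altInner b α _).trans ?_
    gcongr
    calc ∏ i, ‖A (c (I i))‖ ^ 2 ≤ ∏ _i : Fin k, ‖A‖ ^ 2 := by
          refine Finset.prod_le_prod (fun _ _ => by positivity) fun i _ => ?_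
          gcongr
          simpa using A.le_opNorm (c (I i))
      _ = _ := by simp
  have h1 : altInner c (k + 1) (pullback A (k + 1) α) (pullback A (k + 1) α) =
      (k.factorial : ℝ)⁻¹ * ∑ I : Fin k → κ,
        α.form (fun i => A (c (I i))) ^ 2 := by
    simp only [sq]; rfl
  rw [h1]
  calc _ ≤ (k.factorial : ℝ)⁻¹ * ∑ I : Fin k → κ,
        (‖A‖ ^ 2) ^ k * (k.factorial * altInner b (k + 1) α α) := by
        gcongr with I _; exact key I
    _ = _ := by
        rw [Finset.sum_const]
        simp only [Finset.card_univ, Fintype.card_pi, Finset.prod_const, Fintype.card_fin,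
          nsmul_eq_mul, Nat.cast_pow]
        field_simp

variable [FiniteDimensional ℝ V]

instance finiteDimensional_alt (V : Type) [NormedAddCommGroup V] [InnerProductSpace ℝ V]
    [FiniteDimensional ℝ V] : ∀ j : ℕ, FiniteDimensional ℝ (Alt V j)
  | 0 => inferInstanceAs (FiniteDimensional ℝ PUnit)
  | k + 1 => by
      let b := stdOrthonormalBasis ℝ V
      let L : (V [⋀^Fin k]→L[ℝ] ℝ) →ₗ[ℝ] (Fin k → Fin (Module.finrank ℝ V)) → ℝ :=
        { toFun := fun α I => α (fun i => b (I i))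
          map_add' := fun _ _ => rfl
          map_smul' := fun _ _ => rfl }
      have : FiniteDimensional ℝ (V [⋀^Fin k]→L[ℝ] ℝ) := by
        refine FiniteDimensional.of_injective L
          (LinearMap.ker_eq_bot.1 (LinearMap.ker_eq_bot'.2 fun α h => ?_))
        refine ContinuousAlternatingMap.ext fun v => ?_
        have h1 := sq_apply_le_prod_mul_sum b α v
        have h2 : ∀ I : Fin k → Fin (Module.finrank ℝ V), α (fun i => b (I i)) = 0 :=
          fun I => congrFun h I
        simp only [h2] at h1
        simpa using h1
      exact this

theorem continuous_altInner {X : Type*} [TopologicalSpace X] {ι : Type} [Fintype ι] (b : ι → V)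
    (j : ℕ) {α β : X → Alt V j} (hα : Continuous α) (hβ : Continuous β) :
    Continuous fun x => altInner b j (α x) (β x) := by
  let B : Alt V j →L[ℝ] Alt V j →L[ℝ] ℝ :=
    (LinearMap.toContinuousLinearMap (𝕜 := ℝ) (E := Alt V j) (F' := ℝ)).toLinearMap.comp
      (altBilin b j) |>.toContinuousLinearMap
  exact (B.continuous.comp hα).clm_apply hβ

theorem continuous_pullback {X : Type*} [TopologicalSpace X] (A : W →L[ℝ] V)
    (j : ℕ) {α : X → Alt V j} (hα : Continuous α) : Continuous fun x => pullback A j (α x) :=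
  (pullback A j).continuous_of_finiteDimensional.comp hα

end Algebra

/-! ### Forms and Hausdorff integrals under affine maps. -/

variable {n : ℕ}

/-- The inner product of the tangential parts of two alternating forms. -/
def tanInner (D : Submodule ℝ (Euc n)) (j : ℕ) (α β : Alt (Euc n) j) : ℝ :=
  altInner (stdOrthonormalBasis ℝ D) j (pullback D.subtypeL j α) (pullback D.subtypeL j β)

theorem altInner_single (j : ℕ) (α β : Alt (Euc n) j) :
    altInner (fun i : Fin n => EuclideanSpace.single i (1 : ℝ)) j α β =
      altInner (EuclideanSpace.basisFun (Fin n) ℝ) j α β := by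
  congr 1
  funext i
  simp

theorem tanInner_self_nonneg (D : Submodule ℝ (Euc n)) (j : ℕ) (α : Alt (Euc n) j) :
    0 ≤ tanInner D j α α := altInner_self_nonneg _ _ _

theorem continuous_tanInner {X : Type*} [TopologicalSpace X] (D : Submodule ℝ (Euc n)) (j : ℕ)
    {α β : X → Alt (Euc n) j} (hα : Continuous α) (hβ : Continuous β) :
    Continuous fun x => tanInner D j (α x) (β x) :=
  continuous_altInner _ _ (continuous_pullback _ _ hα) (continuous_pullback _ _ hβ)

theorem tanInner_eq_zero_iff (D : Submodule ℝ (Euc n)) (j : ℕ) (α : Alt (Euc n) j) :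
    tanInner D j α α = 0 ↔ pullback D.subtypeL j α = 0 :=
  ⟨fun h => eq_zero_of_altInner_self _ _ _ h, fun h => by simp [tanInner, h]⟩

/-- Restriction to tangent spaces commutes with pullback once A is viewed as a map from D' to D;
bounding the dimension of D' by n makes the constant independent of the facet. -/
theorem tanInner_pullback_le (D D' : Submodule ℝ (Euc n)) (A : Euc n →L[ℝ] Euc n)
    (hA : ∀ x ∈ D', A x ∈ D) (k : ℕ) (α : Alt (Euc n) (k + 1)) :
    tanInner D' (k + 1) (pullback A (k + 1) α) (pullback A (k + 1) α) ≤
      n ^ k * (‖A‖ ^ 2) ^ k * tanInner D (k + 1) α α := by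
  let A' : D' →L[ℝ] D := (A.comp D'.subtypeL).codRestrict D fun x => hA x x.2
  have hA' : ‖A'‖ ≤ ‖A‖ := by
    refine A'.opNorm_le_bound (norm_nonneg _) fun x => ?_
    exact A.le_opNorm x
  have hc : pullback D'.subtypeL (k + 1) (pullback A (k + 1) α) =
      pullback A' (k + 1) (pullback D.subtypeL (k + 1) α) := rfl
  have hd : (Module.finrank ℝ D' : ℝ) ≤ n := by
    have := Submodule.finrank_le D'
    rw [finrank_euclideanSpace_fin] at this
    exact_mod_cast this
  unfold tanInner
  rw [hc]
  refine (altInner_pullback_le (stdOrthonormalBasis ℝ D) (stdOrthonormalBasis ℝ D') A' k _).trans ?_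
  have := altInner_self_nonneg (stdOrthonormalBasis ℝ D) (k + 1) (pullback D.subtypeL (k + 1) α)
  rw [Fintype.card_fin]
  gcongr

/-- The pullback of a form by the affine map `x ↦ A x + b`. -/
def pullForm (A : Euc n →L[ℝ] Euc n) (b : Euc n) (j : ℕ) : Form n j →ₗ[ℝ] Form n j :=
  LinearMap.pi fun x => (pullback A j).comp (LinearMap.proj (A x + b))

theorem continuous_pullForm (A : Euc n →L[ℝ] Euc n) (b : Euc n) (j : ℕ) {τ : Form n j}
    (hτ : Continuous τ) : Continuous (pullForm A b j τ) :=
  continuous_pullback _ _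
    (Continuous.comp hτ (f := fun x => A x + b) (A.continuous.add continuous_const))

/-- An invertible affine map as a homeomorphism. -/
def affHomeo (A : Euc n ≃L[ℝ] Euc n) (b : Euc n) : Euc n ≃ₜ Euc n :=
  A.toHomeomorph.trans (Homeomorph.addRight b)

theorem affHomeo_apply (A : Euc n ≃L[ℝ] Euc n) (b x : Euc n) : affHomeo A b x = A x + b := rfl

theorem affHomeo_symm_apply (A : Euc n ≃L[ℝ] Euc n) (b x : Euc n) :
    (affHomeo A b).symm x = A.symm x + -A.symm b := by
  rw [Homeomorph.symm_apply_eq, affHomeo_apply]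
  simp

theorem lipschitzWith_affHomeo_symm (A : Euc n ≃L[ℝ] Euc n) (b : Euc n) :
    LipschitzWith ‖(A.symm : Euc n →L[ℝ] Euc n)‖₊ (affHomeo A b).symm := by
  refine LipschitzWith.of_dist_le_mul fun x y => ?_
  rw [affHomeo_symm_apply, affHomeo_symm_apply, dist_add_right]
  exact (A.symm : Euc n →L[ℝ] Euc n).lipschitz.dist_le_mul x y

theorem euclideanHausdorffMeasure_image_le {f : Euc n → Euc n} {L : NNReal}
    (hf : LipschitzWith L f) (d : ℕ) (s : Set (Euc n)) :
    (Measure.euclideanHausdorffMeasure d : Measure (Euc n)) (f '' s) ≤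
      (L : ENNReal) ^ d * (Measure.euclideanHausdorffMeasure d : Measure (Euc n)) s := by
  have h := hf.hausdorffMeasure_image_le (d := d) (by positivity) s
  rw [ENNReal.rpow_natCast] at h
  simp only [Measure.euclideanHausdorffMeasure_def, Measure.smul_apply, ENNReal.smul_def,
    smul_eq_mul]
  rw [mul_left_comm]
  gcongr

/-- Only an inequality is needed, so the Lipschitz constant of the inverse map replaces the
Jacobian. This treats cells (d = n) and facets (d = n - 1) alike. -/
theorem setIntegral_comp_affHomeo_le (A : Euc n ≃L[ℝ] Euc n) (b : Euc n) (d : ℕ)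
    (S : Set (Euc n)) {g : Euc n → ℝ} (hg : ∀ x, 0 ≤ g x)
    (hi : IntegrableOn g (affHomeo A b '' S) (Measure.euclideanHausdorffMeasure d)) :
    ∫ x in S, g (affHomeo A b x) ∂(Measure.euclideanHausdorffMeasure d) ≤
      ‖(A.symm : Euc n →L[ℝ] Euc n)‖ ^ d *
        ∫ x in affHomeo A b '' S, g x ∂(Measure.euclideanHausdorffMeasure d) := by
  set e := affHomeo A b
  set L := ‖(A.symm : Euc n →L[ℝ] Euc n)‖₊
  set μ : Measure (Euc n) := Measure.euclideanHausdorffMeasure d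
  have hS : S = e ⁻¹' (e '' S) := (e.injective.preimage_image S).symm
  have h1 : ∫ x in S, g (e x) ∂μ = ∫ y in e '' S, g y ∂(μ.map e) := by
    conv_lhs => rw [hS]
    exact (e.measurableEmbedding.setIntegral_map g (e '' S)).symm
  -- Preimages under e are images under its inverse, which is Lipschitz with constant L.
  have hle : μ.map e ≤ (L ^ d : NNReal) • μ := by
    refine Measure.le_iff.2 fun s hs => ?_
    rw [e.measurableEmbedding.map_apply]
    have : e ⁻¹' s = e.symm '' s := by rw [e.symm.image_eq_preimage_symm]; rfl
    rw [this, Measure.smul_apply, ENNReal.smul_def, smul_eq_mul]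
    simpa using euclideanHausdorffMeasure_image_le (lipschitzWith_affHomeo_symm A b) d s
  rw [h1]
  calc _ ≤ ∫ y in e '' S, g y ∂((L ^ d : NNReal) • μ) := by
        refine integral_mono_measure (Measure.restrict_mono le_rfl hle)
          (Filter.Eventually.of_forall hg) ?_
        rw [Measure.restrict_smul]
        exact hi.smul_measure_nnreal
    _ = _ := by
        rw [Measure.restrict_smul, integral_smul_nnreal_measure]
        simp [NNReal.smul_def, L]

/-- Volume is rewritten as n-dimensional Hausdorff measure so that the preceding change-of-variables
bound applies to cells. -/
theorem ip_eq_hausdorff {j : ℕ} (U : Set (Euc n)) (α β : Form n j) :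
    ip U α β = ∫ x in U, altInner (EuclideanSpace.basisFun (Fin n) ℝ) j (α x) (β x)
      ∂(Measure.euclideanHausdorffMeasure n) := by
  rw [EuclideanSpace.euclideanHausdorffMeasure_eq_volume]
  simp only [ip, altInner_single]

theorem ip_pullForm_le (A : Euc n ≃L[ℝ] Euc n) (b : Euc n) {S : Set (Euc n)} (hS : IsCompact S)
    (k : ℕ) {τ : Form n (k + 1)} (hτ : Continuous τ) :
    ip S (pullForm (A : Euc n →L[ℝ] Euc n) b (k + 1) τ)
        (pullForm (A : Euc n →L[ℝ] Euc n) b (k + 1) τ) ≤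
      n ^ k * (‖(A : Euc n →L[ℝ] Euc n)‖ ^ 2) ^ k * (‖(A.symm : Euc n →L[ℝ] Euc n)‖ ^ n *
        ip (affHomeo A b '' S) τ τ) := by
  rw [ip_eq_hausdorff, ip_eq_hausdorff]
  set c : ℝ := n ^ k * (‖(A : Euc n →L[ℝ] Euc n)‖ ^ 2) ^ k
  set B := EuclideanSpace.basisFun (Fin n) ℝ
  have : IsFiniteMeasureOnCompacts (Measure.euclideanHausdorffMeasure n : Measure (Euc n)) := by
    rw [EuclideanSpace.euclideanHausdorffMeasure_eq_volume]; infer_instance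
  have hg : Continuous fun x => altInner B (k + 1) (τ x) (τ x) := continuous_altInner _ _ hτ hτ
  have hσ := continuous_pullForm (A : Euc n →L[ℝ] Euc n) b (k + 1) hτ
  have hF := (affHomeo A b).continuous
  calc _ ≤ ∫ x in S, c * altInner B (k + 1) (τ (affHomeo A b x)) (τ (affHomeo A b x))
          ∂(Measure.euclideanHausdorffMeasure n) := by
        refine integral_mono ?_ ?_ fun x => ?_
        · exact (continuous_altInner _ _ hσ hσ).continuousOn.integrableOn_compact hS
        · exact (continuous_const.mul (hg.comp hF)).continuousOn.integrableOn_compact hS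
        · have := altInner_pullback_le B B (A : Euc n →L[ℝ] Euc n) k (τ (A x + b))
          rw [Fintype.card_fin] at this
          exact this
    _ = c * ∫ x in S, altInner B (k + 1) (τ (affHomeo A b x)) (τ (affHomeo A b x))
          ∂(Measure.euclideanHausdorffMeasure n) := integral_const_mul _ _
    _ ≤ _ := by
        refine mul_le_mul_of_nonneg_left ?_ (by positivity)
        exact setIntegral_comp_affHomeo_le A b n S
          (g := fun x => altInner B (k + 1) (τ x) (τ x)) (fun x => altInner_self_nonneg _ _ _)
          (hg.continuousOn.integrableOn_compact (hS.image hF))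

/-! ### Integration over a convex hull in its own dimension. -/

section ConvexHull

variable (P : Set (Euc n))

/-- The parametrization of the affine span of `P` by `vectorSpan ℝ P`, with base point `p`. -/
def spanParam (p : Euc n) : vectorSpan ℝ P →ᵃ[ℝ] Euc n where
  toFun y := y.1 + p
  linear := (vectorSpan ℝ P).subtype
  map_vadd' y v := by simp [add_assoc]

theorem isometry_spanParam (p : Euc n) : Isometry (spanParam P p) :=
  Isometry.of_dist_eq fun x y => by
    change dist (x.1 + p) (y.1 + p) = _
    rw [dist_add_right]; rfl

variable {P}

theorem convexHull_subset_range_spanParam {p : Euc n} (hp : p ∈ P) :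
    convexHull ℝ P ⊆ Set.range (spanParam P p) := fun x hx => by
  have hx' : x ∈ affineSpan ℝ P := convexHull_subset_affineSpan P hx
  have := AffineSubspace.vsub_mem_direction hx' (mem_affineSpan ℝ hp)
  rw [direction_affineSpan] at this
  exact ⟨⟨x - p, this⟩, by change x - p + p = x; simp⟩

/-- In the intrinsic coordinates the preimage of P affinely spans the whole space, and a convex set
with this property has interior points. -/
theorem interior_preimage_spanParam_nonempty {p : Euc n} (hp : p ∈ P) :
    (interior (spanParam P p ⁻¹' convexHull ℝ P)).Nonempty := by
  have hconv : Convex ℝ (spanParam P p ⁻¹' convexHull ℝ P) :=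
    (convex_convexHull ℝ P).affine_preimage _
  rw [hconv.interior_nonempty_iff_affineSpan_eq_top]
  have hP : P ⊆ Set.range (spanParam P p) :=
    (subset_convexHull ℝ P).trans (convexHull_subset_range_spanParam hp)
  have h0 : vectorSpan ℝ (spanParam P p ⁻¹' P) = ⊤ := by
    apply Submodule.map_injective_of_injective (f := (vectorSpan ℝ P).subtype)
      (vectorSpan ℝ P).injective_subtype
    have := AffineMap.map_vectorSpan (spanParam P p) (s := spanParam P p ⁻¹' P)
    rw [Set.image_preimage_eq_of_subset hP] at this
    rw [Submodule.map_top, Submodule.range_subtype]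
    exact this
  have hne : (spanParam P p ⁻¹' P).Nonempty := by
    obtain ⟨y, hy⟩ := hP hp
    exact ⟨y, by rw [Set.mem_preimage, hy]; exact hp⟩
  have h1 : affineSpan ℝ (spanParam P p ⁻¹' P) = ⊤ :=
    (AffineSubspace.affineSpan_eq_top_iff_vectorSpan_eq_top_of_nonempty ℝ _ _ hne).2 h0
  exact top_le_iff.1 (h1.symm.le.trans
    (affineSpan_mono ℝ (Set.preimage_mono (subset_convexHull ℝ P))))

theorem isCompact_preimage_spanParam (hc : IsCompact (convexHull ℝ P)) (p : Euc n) :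
    IsCompact (spanParam P p ⁻¹' convexHull ℝ P) :=
  (isometry_spanParam P p).isClosedEmbedding.isCompact_preimage hc

/-- The parametrization is isometric, so surface measure on the hull is the image of Lebesgue
measure; finiteness and positivity statements are thereby read off from the flat case. -/
theorem restrict_convexHull_eq_map {p : Euc n} (hp : p ∈ P) (hc : IsCompact (convexHull ℝ P)) :
    (Measure.euclideanHausdorffMeasure (Module.finrank ℝ (vectorSpan ℝ P)) :
        Measure (Euc n)).restrict (convexHull ℝ P) =
      ((volume : Measure (vectorSpan ℝ P)).restrict
        (spanParam P p ⁻¹' convexHull ℝ P)).map (spanParam P p) := by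
  have hφ := isometry_spanParam P p
  rw [← InnerProductSpace.euclideanHausdorffMeasure_eq_volume,
    ← Measure.restrict_map hφ.continuous.measurable hc.isClosed.measurableSet,
    hφ.map_euclideanHausdorffMeasure, Measure.restrict_restrict hc.isClosed.measurableSet,
    Set.inter_eq_left.2 (convexHull_subset_range_spanParam hp)]

theorem euclideanHausdorffMeasure_convexHull_lt_top (hP : P.Finite) :
    (Measure.euclideanHausdorffMeasure (Module.finrank ℝ (vectorSpan ℝ P)) :
        Measure (Euc n)) (convexHull ℝ P) < ⊤ := by
  rcases P.eq_empty_or_nonempty with rfl | ⟨p, hp⟩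
  · simp
  have hc := hP.isCompact_convexHull ℝ
  have := congrArg (fun μ : Measure (Euc n) => μ Set.univ) (restrict_convexHull_eq_map hp hc)
  simp only [Measure.restrict_apply_univ] at this
  rw [this, Measure.map_apply (isometry_spanParam P p).continuous.measurable MeasurableSet.univ,
    Set.preimage_univ, Measure.restrict_apply_univ]
  exact (isCompact_preimage_spanParam hc p).measure_lt_top

theorem integrableOn_convexHull (hP : P.Finite) {g : Euc n → ℝ} (hg : Continuous g) :
    IntegrableOn g (convexHull ℝ P)
      (Measure.euclideanHausdorffMeasure (Module.finrank ℝ (vectorSpan ℝ P))) := by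
  have hc := hP.isCompact_convexHull ℝ
  obtain ⟨M, hM⟩ := hc.exists_bound_of_continuousOn hg.continuousOn
  exact Measure.integrableOn_of_bounded (M := M)
    (euclideanHausdorffMeasure_convexHull_lt_top hP).ne hg.aestronglyMeasurable
    ((ae_restrict_iff' hc.isClosed.measurableSet).2 (Filter.Eventually.of_forall hM))

/-- In intrinsic coordinates the function vanishes almost everywhere, hence by continuity on the
interior and on its closure. That closure contains the whole hull, since a convex set with nonempty
interior lies in the closure of its interior. -/
theorem eqOn_zero_of_setIntegral_convexHull_eq_zero (hP : P.Finite) {g : Euc n → ℝ}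
    (hg : Continuous g) (h0 : ∀ x, 0 ≤ g x)
    (h : ∫ x in convexHull ℝ P, g x
      ∂(Measure.euclideanHausdorffMeasure (Module.finrank ℝ (vectorSpan ℝ P))) = 0) :
    ∀ x ∈ convexHull ℝ P, g x = 0 := by
  rcases P.eq_empty_or_nonempty with rfl | ⟨p, hp⟩
  · simp
  have hc := hP.isCompact_convexHull ℝ
  have hφ := isometry_spanParam P p
  set Q := spanParam P p ⁻¹' convexHull ℝ P
  have hQ : IsCompact Q := isCompact_preimage_spanParam hc p
  have hgφ : Continuous fun y => g (spanParam P p y) := hg.comp hφ.continuous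
  rw [restrict_convexHull_eq_map hp hc,
    hφ.isClosedEmbedding.measurableEmbedding.integral_map,
    integral_eq_zero_iff_of_nonneg (fun y => h0 _)
      (hgφ.continuousOn.integrableOn_compact hQ)] at h
  have h1 : (fun y => g (spanParam P p y)) =ᵐ[volume.restrict (interior Q)] fun _ => 0 :=
    ae_restrict_of_ae_restrict_of_subset interior_subset h
  have h2 := Measure.eqOn_open_of_ae_eq h1 isOpen_interior hgφ.continuousOn continuousOn_const
  have h3 := h2.closure hgφ continuous_const
  have hQc : Convex ℝ Q := (convex_convexHull ℝ P).affine_preimage _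
  rw [hQc.closure_interior_eq_closure_of_nonempty_interior
    (interior_preimage_spanParam_nonempty hp)] at h3
  intro x hx
  obtain ⟨y, rfl⟩ := convexHull_subset_range_spanParam hp hx
  exact h3 (subset_closure hx)

end ConvexHull

/-! ### Simplices and the affine maps between them. -/

/-- `K` is the vertex set of a nondegenerate `n`-simplex. -/
def IsSimplex (K : Finset (Euc n)) : Prop :=
  AffineIndependent ℝ ((↑) : K → Euc n) ∧ K.card = n + 1

theorem IsSimplex.finrank_facet {K : Finset (Euc n)} (hK : IsSimplex K) (hn : 0 < n)
    {v : Euc n} (hv : v ∈ K) :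
    Module.finrank ℝ (vectorSpan ℝ ((K : Set (Euc n)) \ {v})) = n - 1 := by
  classical
  have h := hK.1.finrank_vectorSpan_image_finset (s := Finset.univ.erase ⟨v, hv⟩) (n := n - 1)
    (by rw [Finset.card_erase_of_mem (Finset.mem_univ _), Finset.card_univ, Fintype.card_coe,
          hK.2]; omega)
  have hs : (K : Set (Euc n)) \ {v} =
      ((Finset.univ.erase (⟨v, hv⟩ : K)).image Subtype.val : Finset (Euc n)) := ?_
  · rw [hs]; exact h
  ext x
  simp only [Set.mem_sdiff, Finset.mem_coe, Set.mem_singleton_iff, Finset.coe_image,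
    Finset.coe_erase, Finset.coe_univ, Set.mem_image, Set.mem_univ, true_and, Subtype.exists]
  constructor
  · rintro ⟨h1, h2⟩
    exact ⟨x, h1, fun h => h2 (congrArg Subtype.val h), rfl⟩
  · rintro ⟨y, h1, h2, rfl⟩
    exact ⟨h1, fun h => h2 (Subtype.ext h)⟩

theorem IsSimplex.affineSpan_eq_top {K : Finset (Euc n)} (hK : IsSimplex K) :
    affineSpan ℝ (K : Set (Euc n)) = ⊤ := by
  have := hK.1.affineSpan_eq_top_iff_card_eq_finrank_add_one.2
    (by rw [Fintype.card_coe, hK.2, finrank_euclideanSpace_fin])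
  simpa using this

theorem isCompact_cell (K : Finset (Euc n)) : IsCompact (cell K) :=
  K.finite_toSet.isCompact_convexHull ℝ

theorem convex_cell (K : Finset (Euc n)) : Convex ℝ (cell K) := convex_convexHull ℝ _

theorem IsSimplex.interior_cell_nonempty {K : Finset (Euc n)} (hK : IsSimplex K) :
    (interior (cell K)).Nonempty :=
  interior_convexHull_nonempty_iff_affineSpan_eq_top.2 hK.affineSpan_eq_top

theorem IsSimplex.cellDiam_pos {K : Finset (Euc n)} (hK : IsSimplex K) (hn : 0 < n) :
    0 < cellDiam K := by
  have h : (cell K).Nontrivial := by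
    have : 1 < K.card := by rw [hK.2]; omega
    obtain ⟨a, ha, b, hb, hab⟩ := Finset.one_lt_card.1 this
    exact ⟨a, subset_convexHull ℝ _ ha, b, subset_convexHull ℝ _ hb, hab⟩
  exact Metric.diam_pos h (isCompact_cell K).isBounded

/-- Any two `n`-simplices are affinely equivalent. -/
theorem IsSimplex.exists_affHomeo_image {K K' : Finset (Euc n)} (hK : IsSimplex K)
    (hK' : IsSimplex K') : ∃ (A : Euc n ≃L[ℝ] Euc n) (b : Euc n),
      (affHomeo A b '' (K : Set (Euc n))) = (K' : Set (Euc n)) := by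
  let e : K ≃ K' := Finset.equivOfCardEq (hK.2.trans hK'.2.symm)
  let B : AffineBasis K ℝ (Euc n) := ⟨(↑), hK.1, by simpa using hK.affineSpan_eq_top⟩
  let B' : AffineBasis K ℝ (Euc n) := ⟨fun i => (e i : Euc n),
    hK'.1.comp_embedding e.toEmbedding, by
      have : Set.range (fun i => (e i : Euc n)) = (K' : Set (Euc n)) := by
        exact (e.surjective.range_comp (Subtype.val : K' → Euc n)).trans (by simp)
      rw [this]; exact hK'.affineSpan_eq_top⟩
  have hne : K.Nonempty := Finset.card_pos.1 (by rw [hK.2]; omega)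
  obtain ⟨i₀, hi₀⟩ := hne
  let i : K := ⟨i₀, hi₀⟩
  -- The linear part matches the edges issuing from vertex i with those issuing from e i; the
  -- translation then sends vertex i to e i.
  let A := ((B.basisOf i).equiv (B'.basisOf i) (Equiv.refl _)).toContinuousLinearEquiv
  refine ⟨A, e i - A i, ?_⟩
  have key : ∀ j : K, affHomeo A (e i - A i) j = e j := fun j => by
    rw [affHomeo_apply]
    have h : A (j - i : Euc n) = (e j : Euc n) - e i := by
      by_cases hj : j = i
      · subst hj; simp
      · have h1 := (B.basisOf i).equiv_apply ⟨j, hj⟩ (B'.basisOf i) (Equiv.refl _)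
        simp only [AffineBasis.basisOf_apply, Equiv.refl_apply] at h1
        exact h1
    rw [map_sub] at h
    rw [add_sub, eq_comm, eq_sub_iff_add_eq]
    rw [sub_eq_sub_iff_add_eq_add] at h
    rw [h]
  ext x
  constructor
  · rintro ⟨y, hy, rfl⟩
    rw [key ⟨y, hy⟩]
    exact (e ⟨y, hy⟩).2
  · intro hx
    obtain ⟨j, hj⟩ := e.surjective ⟨x, hx⟩
    exact ⟨j, j.2, by rw [key, hj]⟩

theorem affHomeo_image_convexHull (A : Euc n ≃L[ℝ] Euc n) (b : Euc n) (s : Set (Euc n)) :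
    affHomeo A b '' convexHull ℝ s = convexHull ℝ (affHomeo A b '' s) := by
  have := AffineMap.image_convexHull
    (A.toLinearEquiv.toLinearMap.toAffineMap + AffineMap.const ℝ (Euc n) b) s
  exact this

theorem affHomeo_image_vectorSpan (A : Euc n ≃L[ℝ] Euc n) (b : Euc n) (s : Set (Euc n)) :
    vectorSpan ℝ (affHomeo A b '' s) =
      (vectorSpan ℝ s).map (A.toLinearEquiv : Euc n →ₗ[ℝ] Euc n) := by
  have := AffineMap.map_vectorSpan
    (A.toLinearEquiv.toLinearMap.toAffineMap + AffineMap.const ℝ (Euc n) b) (s := s)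
  simp only [AffineMap.add_linear, AffineMap.const_linear, add_zero,
    LinearMap.toAffineMap_linear] at this
  exact this.symm

/-- An affine map that sends a set containing a ball into a bounded set has a controlled linear
part. -/
theorem norm_le_of_ball_subset (A : Euc n ≃L[ℝ] Euc n) (b : Euc n) {S S' : Set (Euc n)}
    (hS' : Bornology.IsBounded S') (h : affHomeo A b '' S ⊆ S') {c : Euc n} {ρ : ℝ} (hρ : 0 < ρ)
    (hb : Metric.ball c ρ ⊆ S) : ‖(A : Euc n →L[ℝ] Euc n)‖ ≤ 2 * Metric.diam S' / ρ := by
  have hd : 0 ≤ Metric.diam S' := Metric.diam_nonneg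
  refine ContinuousLinearMap.opNorm_le_of_unit_norm (by positivity) fun x hx => ?_
  -- Half the radius keeps the point inside the open ball, which explains the factor 2 in the bound.
  have h1 : c + (ρ / 2) • x ∈ S := hb (by
    rw [mem_ball_iff_norm, add_sub_cancel_left, norm_smul, hx, Real.norm_of_nonneg (by positivity)]
    linarith)
  have h2 : c ∈ S := hb (Metric.mem_ball_self hρ)
  have h3 := Metric.dist_le_diam_of_mem hS' (h ⟨_, h1, rfl⟩) (h ⟨_, h2, rfl⟩)
  rw [affHomeo_apply, affHomeo_apply, dist_add_right, dist_eq_norm, ← map_sub,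
    add_sub_cancel_left, map_smul, norm_smul, Real.norm_of_nonneg (by positivity)] at h3
  rw [le_div_iff₀ hρ]
  change ‖A x‖ * ρ ≤ _
  linarith

theorem eq_sum_single (x : Euc n) : x = ∑ l, x l • EuclideanSpace.single l (1 : ℝ) := by
  simpa using ((EuclideanSpace.basisFun (Fin n) ℝ).sum_repr x).symm

/-! Polynomial functions -/

/-- Each monomial of P becomes a product of at most deg P factors of degree at most one. This gives
affine invariance of the polynomial spaces. -/
theorem totalDegree_bind₁_le {σ τ : Type*} (Q : σ → MvPolynomial τ ℝ)
    (hQ : ∀ i, (Q i).totalDegree ≤ 1) (P : MvPolynomial σ ℝ) :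
    (MvPolynomial.bind₁ Q P).totalDegree ≤ P.totalDegree := by
  rw [MvPolynomial.bind₁, MvPolynomial.aeval_def, MvPolynomial.eval₂_eq]
  refine MvPolynomial.totalDegree_finsetSum_le fun d hd => ?_
  refine (MvPolynomial.totalDegree_mul _ _).trans ?_
  rw [MvPolynomial.algebraMap_eq, MvPolynomial.totalDegree_C, zero_add]
  refine (MvPolynomial.totalDegree_finsetProd _ _).trans ?_
  refine le_trans (Finset.sum_le_sum fun i _ => ?_) (MvPolynomial.le_totalDegree hd)
  exact (MvPolynomial.totalDegree_pow _ _).trans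
    ((Nat.mul_le_mul_left _ (hQ i)).trans_eq (mul_one _))

theorem totalDegree_pderiv_le {σ : Type*} (i : σ) {r : ℕ} {P : MvPolynomial σ ℝ}
    (hP : P.totalDegree ≤ r + 1) : (MvPolynomial.pderiv i P).totalDegree ≤ r := by
  classical
  rw [P.as_sum, map_sum]
  refine MvPolynomial.totalDegree_finsetSum_le fun d hd => ?_
  rw [MvPolynomial.pderiv_monomial]
  by_cases hi : d i = 0
  · simp [hi]
  refine (MvPolynomial.totalDegree_monomial_le _ _).trans ?_
  have h1 : d.degree ≤ r + 1 := (MvPolynomial.le_totalDegree hd).trans hP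
  have h2 : (d - Finsupp.single i 1) + Finsupp.single i 1 = d :=
    tsub_add_cancel_of_le (by simpa using Nat.one_le_iff_ne_zero.2 hi)
  have h3 := congrArg Finsupp.degree h2
  rw [map_add, Finsupp.degree_single] at h3
  change (d - Finsupp.single i 1).degree ≤ r
  omega

theorem hasFDerivAt_eval (P : MvPolynomial (Fin n) ℝ) (x : Euc n) :
    HasFDerivAt (fun y : Euc n => MvPolynomial.eval (fun i => y i) P)
      (∑ i, MvPolynomial.eval (fun i => x i) (MvPolynomial.pderiv i P) •
        (EuclideanSpace.proj i : Euc n →L[ℝ] ℝ)) x := by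
  induction P using MvPolynomial.induction_on with
  | C a => simpa using hasFDerivAt_const a x
  | add p q hp hq =>
      simp only [map_add, add_smul, Finset.sum_add_distrib]
      exact hp.add hq
  | mul_X p i hp =>
      have hX : HasFDerivAt (fun y : Euc n => y i) (EuclideanSpace.proj i : Euc n →L[ℝ] ℝ) x :=
        (EuclideanSpace.proj i : Euc n →L[ℝ] ℝ).hasFDerivAt
      have := hp.mul hX
      simp only [map_mul, MvPolynomial.eval_X]
      refine this.congr_fderiv ?_
      simp only [Derivation.leibniz, smul_eq_mul, map_add, map_mul, MvPolynomial.eval_X,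
        add_smul, Finset.sum_add_distrib, Finset.smul_sum, mul_smul, MvPolynomial.pderiv_X]
      congr 1
      rw [Finset.sum_eq_single i]
      · simp
      · intro j _ hj
        simp [hj.symm]
      · simp

theorem IsPoly.mono {r s : ℕ} (h : r ≤ s) {g : Euc n → ℝ} (hg : IsPoly r g) : IsPoly s g := by
  obtain ⟨P, hP, h'⟩ := hg
  exact ⟨P, hP.trans h, h'⟩

theorem IsPoly.add {r : ℕ} {g g' : Euc n → ℝ} (hg : IsPoly r g) (hg' : IsPoly r g') :
    IsPoly r fun x => g x + g' x := by
  obtain ⟨P, hP, h⟩ := hg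
  obtain ⟨Q, hQ, h'⟩ := hg'
  exact ⟨P + Q, (MvPolynomial.totalDegree_add P Q).trans (max_le hP hQ), fun x => by simp [h, h']⟩

theorem IsPoly.const_mul {r : ℕ} {g : Euc n → ℝ} (hg : IsPoly r g) (c : ℝ) :
    IsPoly r fun x => c * g x := by
  obtain ⟨P, hP, h⟩ := hg
  exact ⟨c • P, (MvPolynomial.totalDegree_smul_le c P).trans hP, fun x => by simp [h]⟩

theorem IsPoly.coord_mul {r : ℕ} {g : Euc n → ℝ} (hg : IsPoly r g) (i : Fin n) :
    IsPoly (r + 1) fun x => x i * g x := by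
  obtain ⟨P, hP, h⟩ := hg
  refine ⟨MvPolynomial.X i * P, (MvPolynomial.totalDegree_mul _ _).trans ?_, fun x => by simp [h]⟩
  rw [MvPolynomial.totalDegree_X]
  omega

theorem IsPoly.sum {ι : Type*} {r : ℕ} (s : Finset ι) {g : ι → Euc n → ℝ}
    (hg : ∀ i ∈ s, IsPoly r (g i)) : IsPoly r fun x => ∑ i ∈ s, g i x := by
  classical
  induction s using Finset.induction_on with
  | empty => exact ⟨0, by simp, by simp⟩
  | insert a s ha ih =>
      simp only [Finset.sum_insert ha]
      exact (hg a (Finset.mem_insert_self _ _)).add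
        (ih fun i hi => hg i (Finset.mem_insert_of_mem hi))

theorem IsPoly.contDiff {r : ℕ} {g : Euc n → ℝ} (hg : IsPoly r g) : ContDiff ℝ ∞ g := by
  obtain ⟨P, -, h⟩ := hg
  rw [show g = _ from funext h]
  clear h
  induction P using MvPolynomial.induction_on with
  | C a => simpa using contDiff_const
  | add p q hp hq => simpa using hp.add hq
  | mul_X p i hp =>
      simp only [map_mul, MvPolynomial.eval_X]
      exact hp.mul (EuclideanSpace.proj i : Euc n →L[ℝ] ℝ).contDiff

theorem IsPoly.comp_affine {r : ℕ} {g : Euc n → ℝ} (hg : IsPoly r g) (A : Euc n →L[ℝ] Euc n)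
    (b : Euc n) : IsPoly r fun x => g (A x + b) := by
  obtain ⟨P, hP, h⟩ := hg
  let Q : Fin n → MvPolynomial (Fin n) ℝ := fun i =>
    ∑ l, MvPolynomial.C (A (EuclideanSpace.single l 1) i) * MvPolynomial.X l + MvPolynomial.C (b i)
  refine ⟨MvPolynomial.bind₁ Q P, (totalDegree_bind₁_le Q (fun i => ?_) P).trans hP, fun x => ?_⟩
  · refine (MvPolynomial.totalDegree_add _ _).trans (max_le ?_ (by simp))
    refine MvPolynomial.totalDegree_finsetSum_le fun l _ => ?_
    refine (MvPolynomial.totalDegree_mul _ _).trans ?_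
    simp
  · change g (A x + b) = _
    rw [h]
    have : MvPolynomial.eval (fun i => x i) (MvPolynomial.bind₁ Q P) =
        MvPolynomial.eval (fun i => MvPolynomial.eval (fun i => x i) (Q i)) P := by
      have := MvPolynomial.eval₂Hom_bind₁ (RingHom.id ℝ) (fun i => x i) Q P
      exact this
    rw [this]
    congr 2
    funext i
    conv_lhs => rw [eq_sum_single x]
    simp [Q, map_sum, mul_comm]

theorem IsPoly.fderiv_apply {r : ℕ} {g : Euc n → ℝ} (hg : IsPoly (r + 1) g) (e : Euc n) :
    IsPoly r fun x => fderiv ℝ g x e := by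
  obtain ⟨P, hP, h⟩ := hg
  have : (fun x => fderiv ℝ g x e) = fun x => ∑ i, e i *
      MvPolynomial.eval (fun i => x i) (MvPolynomial.pderiv i P) := by
    funext x
    rw [show g = _ from funext h, (hasFDerivAt_eval P x).fderiv]
    simp [mul_comm]
  rw [this]
  exact IsPoly.sum _ fun i _ => IsPoly.const_mul ⟨_, totalDegree_pderiv_le i hP, fun _ => rfl⟩ _

/-! Polynomial forms -/

theorem form_eq_sum {j : ℕ} (v : Form n j) : v = fun x =>
    ∑ i, (Module.finBasis ℝ (Alt (Euc n) j)).coord i (v x) • Module.finBasis ℝ (Alt (Euc n) j) i :=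
  funext fun x => ((Module.finBasis ℝ (Alt (Euc n) j)).sum_repr (v x)).symm

theorem contDiff_of_mem_polyForms {r j : ℕ} {v : Form n j} (hv : v ∈ polyForms n r j) :
    ContDiff ℝ ∞ v := by
  rw [form_eq_sum v]
  exact ContDiff.sum fun i _ => (hv _).contDiff.smul contDiff_const

theorem polyForms_mono {r s : ℕ} (h : r ≤ s) (j : ℕ) : polyForms n r j ≤ polyForms n s j :=
  fun _ hv ℓ => (hv ℓ).mono h

/-- Every such form is the image of a tuple of coefficient polynomials of bounded total degree.
Finite dimension is what makes the lifting bound on the reference simplex available. -/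
instance finiteDimensional_polyForms (r j : ℕ) : FiniteDimensional ℝ (polyForms n r j) := by
  let b := Module.finBasis ℝ (Alt (Euc n) j)
  let L : (Fin (Module.finrank ℝ (Alt (Euc n) j)) → MvPolynomial.restrictTotalDegree (Fin n) ℝ r)
      →ₗ[ℝ] Form n j :=
    { toFun := fun P x => ∑ i, MvPolynomial.eval (fun l => x l) (P i : MvPolynomial (Fin n) ℝ) • b i
      map_add' := fun P Q => by
        funext x
        simp [add_smul, Finset.sum_add_distrib]
      map_smul' := fun c P => by
        funext x
        simp [mul_smul, Finset.smul_sum] }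
  have : polyForms n r j ≤ LinearMap.range L := fun v hv => by
    choose P hP h using fun i => hv (b.coord i)
    refine ⟨fun i => ⟨P i, (MvPolynomial.mem_restrictTotalDegree _ _ _).2 (hP i)⟩, ?_⟩
    rw [form_eq_sum v]
    funext x
    change ∑ i, MvPolynomial.eval (fun l => x l) (P i) • b i = ∑ i, b.coord i (v x) • b i
    exact Finset.sum_congr rfl fun i _ => congrArg (· • b i) (h i x).symm
  exact Submodule.finiteDimensional_of_le this

theorem pullForm_mem_polyForms (A : Euc n →L[ℝ] Euc n) (b : Euc n) {r j : ℕ} {v : Form n j}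
    (hv : v ∈ polyForms n r j) : pullForm A b j v ∈ polyForms n r j :=
  fun ℓ => (hv (ℓ.comp (pullback A j))).comp_affine A b

/-- The contraction with a vector in terms of the coordinates of the vector. -/
theorem contract_sum_smul {j : ℕ} (α : Alt (Euc n) (j + 1)) (x : Euc n) :
    contract x j α = ∑ i, x i • contract (EuclideanSpace.single i (1 : ℝ)) j α := by
  cases j with
  | zero => rfl
  | succ k =>
      let L : Euc n →ₗ[ℝ] Alt (Euc n) (k + 1) :=
        (ContinuousAlternatingMap.curryLeft α.form).toLinearMap
      change L x = ∑ i, x i • L (EuclideanSpace.single i (1 : ℝ))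
      conv_lhs => rw [eq_sum_single x]
      simp only [map_sum, map_smul]

theorem koszul_mem_polyForms {r j : ℕ} {v : Form n (j + 1)} (hv : v ∈ polyForms n r (j + 1)) :
    koszul n j v ∈ polyForms n (r + 1) j := fun ℓ => by
  have : (fun x => ℓ (koszul n j v x)) = fun x =>
      ∑ i, x i * (ℓ.comp (contract (EuclideanSpace.single i (1 : ℝ)) j)) (v x) := by
    funext x
    change ℓ (contract x j (v x)) = _
    rw [contract_sum_smul]
    simp
  rw [this]
  exact IsPoly.sum _ fun i _ => (hv _).coord_mul i

theorem trimmedForms_le (r j : ℕ) : trimmedForms n r j ≤ polyForms n (r + 1) j :=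
  sup_le (polyForms_mono (Nat.le_succ r) j)
    (Submodule.map_le_iff_le_comap.2 fun _ hv => koszul_mem_polyForms hv)

theorem pullback_contract (A : Euc n →L[ℝ] Euc n) (x : Euc n) :
    ∀ (j : ℕ) (α : Alt (Euc n) (j + 1)),
      pullback A j (contract (A x) j α) = contract x j (pullback A (j + 1) α)
  | 0, _ => rfl
  | k + 1, α => by
      refine ContinuousAlternatingMap.ext fun v => ?_
      change α.form (Matrix.vecCons (A x) fun i => A (v i)) =
        α.form fun i => A (Matrix.vecCons x v i)
      congr 1
      funext i
      refine Fin.cases rfl (fun i => rfl) i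

theorem contract_add (j : ℕ) (x y : Euc n) (α : Alt (Euc n) (j + 1)) :
    contract (x + y) j α = contract x j α + contract y j α := by
  rw [contract_sum_smul α (x + y), contract_sum_smul α x, contract_sum_smul α y,
    ← Finset.sum_add_distrib]
  simp [add_smul]

/-- The Koszul operator contracts with A x + b at the image point. The A x part pulls back to the
Koszul operator again; the b part is a contraction with a constant vector, which keeps degree r and
is absorbed by the full space `polyForms n r j`. -/
theorem pullForm_mem_trimmedForms (A : Euc n →L[ℝ] Euc n) (b : Euc n) {r j : ℕ} {v : Form n j}
    (hv : v ∈ trimmedForms n r j) : pullForm A b j v ∈ trimmedForms n r j := by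
  obtain ⟨w, hw, _, ⟨u, hu, rfl⟩, rfl⟩ := Submodule.mem_sup.1 hv
  rw [map_add]
  refine add_mem (Submodule.mem_sup_left (pullForm_mem_polyForms A b hw)) ?_
  have : pullForm A b j (koszul n j u) = koszul n j (pullForm A b (j + 1) u) +
      fun x => (pullback A j ∘ₗ contract b j) (u (A x + b)) := by
    funext x
    change pullback A j (contract (A x + b) j (u (A x + b))) =
      contract x j (pullback A (j + 1) (u (A x + b))) + pullback A j (contract b j (u (A x + b)))
    rw [contract_add, map_add, pullback_contract]
  rw [this]
  exact add_mem (Submodule.mem_sup_right ⟨_, pullForm_mem_polyForms A b hu, rfl⟩)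
    (Submodule.mem_sup_left fun ℓ => (hu (ℓ ∘ₗ pullback A j ∘ₗ contract b j)).comp_affine A b)

/-! The exterior derivative -/

theorem extD_zero_degree (α : Form n 0) : extD 0 α = 0 := rfl

theorem extD_add {j : ℕ} {v w : Form n j} (hv : ContDiff ℝ ∞ v) (hw : ContDiff ℝ ∞ w) :
    extD j (v + w) = extD j v + extD j w := by
  cases j with
  | zero => exact (add_zero _).symm
  | succ k => exact funext fun x => 
      extDeriv_add (show DifferentiableAt ℝ (show Euc n → Euc n [⋀^Fin k]→L[ℝ] ℝ from v) x from
        hv.differentiable (by simp) x) (hw.differentiable (by simp) x)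

theorem extD_smul {j : ℕ} (c : ℝ) (v : Form n j) : extD j (c • v) = c • extD j v := by
  cases j with
  | zero => exact (smul_zero _).symm
  | succ k =>
      exact funext fun x => extDeriv_smul c (show Euc n → Euc n [⋀^Fin k]→L[ℝ] ℝ from v)

@[simp] theorem extD_zero (j : ℕ) : extD j (0 : Form n j) = 0 := by
  have := extD_smul 0 (0 : Form n j)
  rwa [zero_smul, zero_smul] at this

theorem extD_pullForm {k : ℕ} (A : Euc n →L[ℝ] Euc n) (b : Euc n) {v : Form n (k + 1)}
    (hv : ContDiff ℝ ∞ v) :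
    extD (k + 1) (pullForm A b (k + 1) v) = pullForm A b (k + 2) (extD (k + 1) v) := by
  funext x
  have hf : ∀ y, fderiv ℝ (fun x => A x + b) y = A := fun y =>
    (A.hasFDerivAt.add_const b).fderiv
  have hd : DifferentiableAt ℝ (show Euc n → Euc n [⋀^Fin k]→L[ℝ] ℝ from v) (A x + b) :=
    hv.differentiable (by simp) _
  have h := extDeriv_pullback (f := fun x => A x + b) (r := 2) hd (by fun_prop) (by simp)
  simp only [hf] at h
  exact h

/-- The antisymmetrization that maps the derivative of a form to its exterior derivative. -/
def skew (n k : ℕ) : (Euc n →L[ℝ] Alt (Euc n) (k + 1)) →ₗ[ℝ] Alt (Euc n) (k + 2) :=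
  (ContinuousAlternatingMap.alternatizeUncurryFinCLM ℝ (Euc n) ℝ (n := k)).toLinearMap

theorem extD_eq {k : ℕ} (v : Form n (k + 1)) (x : Euc n) :
    extD (k + 1) v x = skew n k (fderiv ℝ v x) := rfl

/-- The coefficients of dv are constant linear combinations of first partial derivatives of the
coefficients of v. -/
theorem extD_mem_polyForms {r : ℕ} : ∀ {j : ℕ} {v : Form n j}, v ∈ polyForms n (r + 1) j →
    extD j v ∈ polyForms n r (j + 1)
  | 0, _, _ => Submodule.zero_mem _
  | k + 1, v, hv => fun ℓ => by
      let b := Module.finBasis ℝ (Alt (Euc n) (k + 1))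
      have hd : ∀ x, HasFDerivAt v (∑ i, (fderiv ℝ (fun y => b.coord i (v y)) x).smulRight (b i)) x :=
        fun x => by
          conv => arg 1; rw [form_eq_sum v]
          refine HasFDerivAt.fun_sum fun i _ => ?_
          exact (((hv _).contDiff.differentiable (by simp) x).hasFDerivAt).smul_const (b i)
      have key : (fun x => ℓ (extD (k + 1) v x)) = fun x => ∑ i, ∑ l : Fin n,
          ℓ (skew n k ((EuclideanSpace.proj l : Euc n →L[ℝ] ℝ).smulRight (b i))) *
          fderiv ℝ (fun y => b.coord i (v y)) x (EuclideanSpace.single l 1) := by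
        funext x
        rw [extD_eq, (hd x).fderiv]
        have h2 : ∀ i, (fderiv ℝ (fun y => b.coord i (v y)) x).smulRight (b i) =
            ∑ l : Fin n, (fderiv ℝ (fun y => b.coord i (v y)) x (EuclideanSpace.single l 1)) •
              (EuclideanSpace.proj l : Euc n →L[ℝ] ℝ).smulRight (b i) := fun i => by
          refine ContinuousLinearMap.ext fun y => ?_
          have hy : fderiv ℝ (fun y => b.coord i (v y)) x y = ∑ l : Fin n,
              fderiv ℝ (fun y => b.coord i (v y)) x (EuclideanSpace.single l 1) * y l := by
            conv_lhs => rw [eq_sum_single y]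
            simp only [map_sum, map_smul, smul_eq_mul, mul_comm]
          rw [sum_apply]
          change fderiv ℝ (fun y => b.coord i (v y)) x y • b i = ∑ l : Fin n,
            fderiv ℝ (fun y => b.coord i (v y)) x (EuclideanSpace.single l 1) • (y l • b i)
          rw [hy, Finset.sum_smul]
          exact Finset.sum_congr rfl fun l _ => mul_smul _ _ _
        simp only [h2, map_sum, map_smul, smul_eq_mul, mul_comm]
      rw [key]
      exact IsPoly.sum _ fun i _ => IsPoly.sum _ fun l _ => ((hv _).fderiv_apply _).const_mul _

theorem lowSpace_le (r j : ℕ) : ∀ κ, lowSpace n r j κ ≤ polyForms n (r + 1) j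
  | .full => le_rfl
  | .trimmed => trimmedForms_le r j

theorem highSpace_le (r j : ℕ) : ∀ κ, highSpace n r j κ ≤ polyForms n (r + 1) j
  | .full => polyForms_mono (Nat.le_succ r) j
  | .trimmed => trimmedForms_le r j

theorem le_highSpace (r j : ℕ) : ∀ κ, polyForms n r j ≤ highSpace n r j κ
  | .full => le_rfl
  | .trimmed => le_sup_left

/-- Both choices of the lower space have degree at most r + 1 and both choices of the upper space
contain all of degree r, so every combination of families is covered. This lets P_h u replace u when
paired with dτ. -/
theorem extD_mem_highSpace {r j : ℕ} {κ₀ : Kind} (κ₁ : Kind) {v : Form n j}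
    (hv : v ∈ lowSpace n r j κ₀) : extD j v ∈ highSpace n r (j + 1) κ₁ :=
  le_highSpace r (j + 1) κ₁ (extD_mem_polyForms (lowSpace_le r j κ₀ hv))

theorem pullForm_mem_lowSpace {r j : ℕ} (A : Euc n →L[ℝ] Euc n) (b : Euc n) :
    ∀ (κ : Kind) {v : Form n j}, v ∈ lowSpace n r j κ → pullForm A b j v ∈ lowSpace n r j κ
  | .full, _, hv => pullForm_mem_polyForms A b hv
  | .trimmed, _, hv => pullForm_mem_trimmedForms A b hv

theorem pullForm_mem_highSpace {r j : ℕ} (A : Euc n →L[ℝ] Euc n) (b : Euc n) :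
    ∀ (κ : Kind) {v : Form n j}, v ∈ highSpace n r j κ → pullForm A b j v ∈ highSpace n r j κ
  | .full, _, hv => pullForm_mem_polyForms A b hv
  | .trimmed, _, hv => pullForm_mem_trimmedForms A b hv

/-! Square integrable forms -/

theorem MemL2.integrable {j : ℕ} {U : Set (Euc n)} {α β : Form n j} (hα : MemL2 U α)
    (hβ : MemL2 U β) : Integrable (fun x => altInner
      (fun i : Fin n => EuclideanSpace.single i (1 : ℝ)) j (α x) (β x)) (volume.restrict U) := by
  cases j with
  | zero => exact integrable_zero _ _ _
  | succ k =>
      refine Integrable.const_mul (integrable_finsetSum _ fun I _ => ?_) _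
      let L : Alt (Euc n) (k + 1) →L[ℝ] ℝ := LinearMap.toContinuousLinearMap
        { toFun := fun ξ => ξ.form (fun i => EuclideanSpace.single (I i) 1)
          map_add' := fun _ _ => rfl
          map_smul' := fun _ _ => rfl }
      exact (L.comp_memLp' hα).integrable_mul (L.comp_memLp' hβ)

theorem ip_comm {j : ℕ} (U : Set (Euc n)) (α β : Form n j) : ip U α β = ip U β α := by
  simp only [ip, altInner_comm _ _ (α _)]

theorem ip_add_left {j : ℕ} {U : Set (Euc n)} {α α' β : Form n j} (hα : MemL2 U α)
    (hα' : MemL2 U α') (hβ : MemL2 U β) : ip U (α + α') β = ip U α β + ip U α' β := by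
  rw [ip, ip, ip, ← integral_add (hα.integrable hβ) (hα'.integrable hβ)]
  simp only [Pi.add_apply, altInner_add_left]

theorem ip_smul_left {j : ℕ} (U : Set (Euc n)) (c : ℝ) (α β : Form n j) :
    ip U (c • α) β = c * ip U α β := by
  rw [ip, ip, ← integral_const_mul]
  simp only [Pi.smul_apply, altInner_smul_left]

theorem ip_add_right {j : ℕ} {U : Set (Euc n)} {α β β' : Form n j} (hα : MemL2 U α)
    (hβ : MemL2 U β) (hβ' : MemL2 U β') : ip U α (β + β') = ip U α β + ip U α β' := by
  rw [ip_comm, ip_add_left hβ hβ' hα, ip_comm U β, ip_comm U β']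

theorem ip_smul_right {j : ℕ} (U : Set (Euc n)) (c : ℝ) (α β : Form n j) :
    ip U α (c • β) = c * ip U α β := by
  rw [ip_comm, ip_smul_left, ip_comm]

theorem ip_sub_left {j : ℕ} {U : Set (Euc n)} {α α' β : Form n j} (hα : MemL2 U α)
    (hα' : MemL2 U α') (hβ : MemL2 U β) : ip U (α - α') β = ip U α β - ip U α' β := by
  have h : MemL2 U ((-1 : ℝ) • α') := MemLp.const_smul hα' (-1 : ℝ)
  have h2 : α - α' = α + (-1 : ℝ) • α' := by simp [sub_eq_add_neg]
  rw [h2, ip_add_left hα h hβ, ip_smul_left]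
  ring

@[simp] theorem ip_zero_left {j : ℕ} (U : Set (Euc n)) (β : Form n j) : ip U 0 β = 0 := by
  have := ip_smul_left U 0 (0 : Form n j) β
  rwa [zero_smul, zero_mul] at this

@[simp] theorem ip_zero_right {j : ℕ} (U : Set (Euc n)) (β : Form n j) : ip U β 0 = 0 := by
  rw [ip_comm, ip_zero_left]

theorem ip_self_nonneg {j : ℕ} (U : Set (Euc n)) (α : Form n j) : 0 ≤ ip U α α :=
  integral_nonneg fun _ => altInner_self_nonneg _ _ _

theorem nrm_nonneg {j : ℕ} (U : Set (Euc n)) (α : Form n j) : 0 ≤ nrm U α := Real.sqrt_nonneg _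

theorem nrm_sq {j : ℕ} (U : Set (Euc n)) (α : Form n j) : nrm U α ^ 2 = ip U α α :=
  Real.sq_sqrt (ip_self_nonneg U α)

/-- The Cauchy--Schwarz inequality. -/
theorem abs_ip_le {j : ℕ} {U : Set (Euc n)} {α β : Form n j} (hα : MemL2 U α)
    (hβ : MemL2 U β) : |ip U α β| ≤ nrm U α * nrm U β := by
  have h : ∀ t : ℝ, 0 ≤ ip U β β * (t * t) + (2 * ip U α β) * t + ip U α α := fun t => by
    have ht : MemL2 U (t • β) := MemLp.const_smul hβ t
    have := ip_self_nonneg U (α + t • β)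
    rw [ip_add_left hα ht (MemLp.add hα ht), ip_add_right hα hα ht, ip_add_right ht hα ht,
      ip_smul_left, ip_smul_left, ip_smul_right, ip_smul_right, ip_comm U β α] at this
    linarith
  have hd := discrim_le_zero h
  rw [discrim] at hd
  rw [← abs_of_nonneg (nrm_nonneg U α), ← abs_of_nonneg (nrm_nonneg U β), ← abs_mul,
    ← sq_le_sq, mul_pow, nrm_sq, nrm_sq]
  linarith

theorem memL2_cell_of_continuous {j : ℕ} (K : Finset (Euc n)) {α : Form n j}
    (hα : Continuous α) : MemL2 (cell K) α := by
  have hK := isCompact_cell K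
  obtain ⟨M, hM⟩ := hK.exists_bound_of_continuousOn hα.continuousOn
  have : IsFiniteMeasure (volume.restrict (cell K)) := ⟨by
    rw [Measure.restrict_apply_univ]; exact hK.measure_lt_top⟩
  exact MemLp.of_bound (hα.aestronglyMeasurable) M
    ((ae_restrict_iff' hK.isClosed.measurableSet).2 (Filter.Eventually.of_forall hM))

/-! The boundary inner product of tangential traces -/

/-- The boundary inner product of the tangential traces of two forms. -/
def facetIp {j : ℕ} (K : Finset (Euc n)) (τ τ' : Form n j) : ℝ :=
  ∑ v ∈ K, ∫ x in convexHull ℝ ((K : Set (Euc n)) \ {v}),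
    tanInner (vectorSpan ℝ ((K : Set (Euc n)) \ {v})) j (τ x) (τ' x)
      ∂(Measure.euclideanHausdorffMeasure (n - 1) : Measure (Euc n))

/-- The cut-off in `tanTrace` is inactive on the facet of integration, so the integrand may be
replaced by one that is continuous on all of space for continuous forms. -/
theorem bdIp_tanTrace {j : ℕ} (K : Finset (Euc n)) (τ τ' : Form n j) :
    bdIp K (tanTrace K j τ) (tanTrace K j τ') = facetIp K τ τ' := by
  rw [facetIp, ← Finset.sum_coe_sort K]
  refine Finset.sum_congr rfl fun v _ => ?_
  refine setIntegral_congr_fun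
    ((K.finite_toSet.subset Set.sdiff_subset).isCompact_convexHull ℝ).isClosed.measurableSet
    fun x hx => ?_
  have h : ∀ η : Form n j, tanTrace K j η v x = pullback (facetDir K v).subtypeL j (η x) :=
    fun η => by
      simp only [tanTrace, LinearMap.pi_apply]
      rw [if_pos (show x ∈ facet K v from hx)]
      rfl
  simp only [h]
  rfl

theorem facetIp_self_nonneg {j : ℕ} (K : Finset (Euc n)) (τ : Form n j) : 0 ≤ facetIp K τ τ :=
  Finset.sum_nonneg fun _ _ => integral_nonneg fun _ => tanInner_self_nonneg _ _ _

theorem facetIp_comm {j : ℕ} (K : Finset (Euc n)) (τ τ' : Form n j) :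
    facetIp K τ τ' = facetIp K τ' τ := by
  simp only [facetIp, tanInner, altInner_comm _ j (pullback _ j (τ _))]

theorem facetIp_smul_left {j : ℕ} (K : Finset (Euc n)) (c : ℝ) (τ τ' : Form n j) :
    facetIp K (c • τ) τ' = c * facetIp K τ τ' := by
  simp only [facetIp, tanInner, Pi.smul_apply, map_smul, altInner_smul_left, integral_const_mul,
    Finset.mul_sum]

theorem IsSimplex.integrableOn_facet {K : Finset (Euc n)} (hK : IsSimplex K) (hn : 0 < n)
    {v : Euc n} (hv : v ∈ K) {g : Euc n → ℝ} (hg : Continuous g) :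
    IntegrableOn g (convexHull ℝ ((K : Set (Euc n)) \ {v}))
      (Measure.euclideanHausdorffMeasure (n - 1)) := by
  have := integrableOn_convexHull (K.finite_toSet.subset (Set.sdiff_subset (t := {v}))) hg
  rwa [hK.finrank_facet hn hv] at this

theorem IsSimplex.facetIp_add_left {j : ℕ} {K : Finset (Euc n)} (hK : IsSimplex K) (hn : 0 < n)
    {τ τ' η : Form n j} (hτ : Continuous τ) (hτ' : Continuous τ') (hη : Continuous η) :
    facetIp K (τ + τ') η = facetIp K τ η + facetIp K τ' η := by
  rw [facetIp, facetIp, facetIp, ← Finset.sum_add_distrib]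
  refine Finset.sum_congr rfl fun v hv => ?_
  rw [← integral_add (hK.integrableOn_facet hn hv (continuous_tanInner _ _ hτ hη))
    (hK.integrableOn_facet hn hv (continuous_tanInner _ _ hτ' hη))]
  simp only [tanInner, Pi.add_apply, map_add, altInner_add_left]

/-- On each facet a nonnegative continuous integrand has zero integral and so vanishes pointwise;
off the facet the trace is zero by convention. Thus the boundary norm detects traces exactly, not
just almost everywhere. -/
theorem IsSimplex.tanTrace_eq_zero {j : ℕ} {K : Finset (Euc n)} (hK : IsSimplex K) (hn : 0 < n)
    {τ : Form n j} (hτ : Continuous τ) (h : facetIp K τ τ = 0) : tanTrace K j τ = 0 := by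
  funext v x
  simp only [tanTrace, LinearMap.pi_apply]
  split_ifs with hx
  · have h1 := (Finset.sum_eq_zero_iff_of_nonneg fun _ _ =>
      integral_nonneg fun _ => tanInner_self_nonneg _ _ _).1 h v.1 v.2
    rw [← hK.finrank_facet hn v.2] at h1
    have h2 := eqOn_zero_of_setIntegral_convexHull_eq_zero
      (K.finite_toSet.subset Set.sdiff_subset) (continuous_tanInner _ j hτ hτ)
      (fun x => tanInner_self_nonneg _ _ _) h1 x hx
    exact (tanInner_eq_zero_iff _ _ _).1 h2
  · rfl

/-- The facet opposite v is carried to the facet opposite its image and its tangent space is carried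
along by A, so the bound holds facet by facet; the exponent n - 1 is the facet dimension. -/
theorem IsSimplex.facetIp_pullForm_le {K K' : Finset (Euc n)} (hK : IsSimplex K)
    (hK' : IsSimplex K') (hn : 0 < n)
    (A : Euc n ≃L[ℝ] Euc n) (b : Euc n)
    (h : affHomeo A b '' (K : Set (Euc n)) = (K' : Set (Euc n))) (k : ℕ) {τ : Form n (k + 1)}
    (hτ : Continuous τ) :
    facetIp K (pullForm (A : Euc n →L[ℝ] Euc n) b (k + 1) τ)
        (pullForm (A : Euc n →L[ℝ] Euc n) b (k + 1) τ) ≤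
      n ^ k * (‖(A : Euc n →L[ℝ] Euc n)‖ ^ 2) ^ k * (‖(A.symm : Euc n →L[ℝ] Euc n)‖ ^ (n - 1) *
        facetIp K' τ τ) := by
  classical
  have hKK : K' = K.image (affHomeo A b) := Finset.coe_injective (by simp [h])
  set c : ℝ := n ^ k * (‖(A : Euc n →L[ℝ] Euc n)‖ ^ 2) ^ k
  have hsum : facetIp K' τ τ = ∑ v ∈ K,
      ∫ x in convexHull ℝ ((K' : Set (Euc n)) \ {affHomeo A b v}),
        tanInner (vectorSpan ℝ ((K' : Set (Euc n)) \ {affHomeo A b v})) (k + 1) (τ x) (τ x)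
          ∂(Measure.euclideanHausdorffMeasure (n - 1) : Measure (Euc n)) := by
    unfold facetIp
    conv_lhs => rw [Finset.sum_congr hKK (fun _ _ => rfl)]
    exact Finset.sum_image fun x _ y _ hxy => (affHomeo A b).injective hxy
  rw [hsum, Finset.mul_sum, Finset.mul_sum]
  refine Finset.sum_le_sum fun v hv => ?_
  have hv' : affHomeo A b v ∈ K' := by rw [hKK]; exact Finset.mem_image_of_mem _ hv
  set D := vectorSpan ℝ ((K : Set (Euc n)) \ {v})
  have himg : affHomeo A b '' ((K : Set (Euc n)) \ {v}) =
      (K' : Set (Euc n)) \ {affHomeo A b v} := by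
    rw [Set.image_sdiff (affHomeo A b).injective, h, Set.image_singleton]
  have hD : vectorSpan ℝ ((K' : Set (Euc n)) \ {affHomeo A b v}) =
      D.map (A.toLinearEquiv : Euc n →ₗ[ℝ] Euc n) := by
    rw [← himg, affHomeo_image_vectorSpan]
  set D' := vectorSpan ℝ ((K' : Set (Euc n)) \ {affHomeo A b v})
  have hS : affHomeo A b '' convexHull ℝ ((K : Set (Euc n)) \ {v}) =
      convexHull ℝ ((K' : Set (Euc n)) \ {affHomeo A b v}) := by
    rw [affHomeo_image_convexHull, himg]
  set S := convexHull ℝ ((K : Set (Euc n)) \ {v})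
  have hg : Continuous fun x => tanInner D' (k + 1) (τ x) (τ x) := continuous_tanInner _ _ hτ hτ
  have hi := hK'.integrableOn_facet hn hv' hg
  rw [← hS] at hi ⊢
  have hmain := setIntegral_comp_affHomeo_le A b (n - 1) S (fun x => tanInner_self_nonneg _ _ _) hi
  have hpt : ∀ x, tanInner D (k + 1) (pullForm (A : Euc n →L[ℝ] Euc n) b (k + 1) τ x)
      (pullForm (A : Euc n →L[ℝ] Euc n) b (k + 1) τ x) ≤
      c * tanInner D' (k + 1) (τ (affHomeo A b x)) (τ (affHomeo A b x)) := fun x =>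
    tanInner_pullback_le D' D (A : Euc n →L[ℝ] Euc n)
      (fun y hy => by rw [hD]; exact ⟨y, hy, rfl⟩) k (τ (A x + b))
  calc _ ≤ ∫ x in S, c * tanInner D' (k + 1) (τ (affHomeo A b x)) (τ (affHomeo A b x))
          ∂(Measure.euclideanHausdorffMeasure (n - 1)) := by
        refine integral_mono_of_nonneg (Filter.Eventually.of_forall fun x =>
          tanInner_self_nonneg _ _ _) ?_ (Filter.Eventually.of_forall hpt)
        refine Integrable.const_mul ?_ _
        exact hK.integrableOn_facet hn hv (hg.comp (affHomeo A b).continuous)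
    _ = c * ∫ x in S, tanInner D' (k + 1) (τ (affHomeo A b x)) (τ (affHomeo A b x))
          ∂(Measure.euclideanHausdorffMeasure (n - 1)) := integral_const_mul _ _
    _ ≤ _ := mul_le_mul_of_nonneg_left hmain (by positivity)

/-! Equivalence of quadratic forms -/

theorem exists_bound_norm_sq {E : Type*} [NormedAddCommGroup E] [InnerProductSpace ℝ E]
    [FiniteDimensional ℝ E] (B : E →ₗ[ℝ] E →ₗ[ℝ] ℝ) :
    ∃ C : ℝ, 0 < C ∧ ∀ x, B x x ≤ C * inner ℝ x x := by
  let L : E →L[ℝ] E →L[ℝ] ℝ := LinearMap.toContinuousLinearMap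
    ((LinearMap.toContinuousLinearMap (𝕜 := ℝ) (E := E) (F' := ℝ)).toLinearMap.comp B)
  refine ⟨‖L‖ + 1, by positivity, fun x => ?_⟩
  have h1 : B x x ≤ ‖L‖ * ‖x‖ * ‖x‖ := (le_abs_self _).trans (L.le_opNorm₂ x x)
  rw [real_inner_self_eq_norm_mul_norm x]
  nlinarith [mul_self_nonneg ‖x‖]

/-- B is taken as the inner product of E; in finite dimension any other bilinear form is then
bounded. -/
theorem exists_bound_of_posDef {E : Type*} [AddCommGroup E] [Module ℝ E] [FiniteDimensional ℝ E]
    (B B₁ : E →ₗ[ℝ] E →ₗ[ℝ] ℝ) (hs : ∀ x y, B x y = B y x) (h0 : ∀ x, 0 ≤ B x x)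
    (hd : ∀ x, B x x = 0 → x = 0) : ∃ C : ℝ, 0 < C ∧ ∀ x, B₁ x x ≤ C * B x x := by
  let core : InnerProductSpace.Core ℝ E :=
    { inner := fun x y => B x y
      conj_inner_symm := fun x y => hs y x
      re_inner_nonneg := fun x => h0 x
      add_left := fun x y z => by simp
      smul_left := fun x y r => by simp
      definite := hd }
  exact @exists_bound_norm_sq E core.toNormedAddCommGroup (InnerProductSpace.ofCore core.toCore)
    ‹_› B₁

/-- The witness y is the component of x in a complement of the kernel of B: x - y is invisible to B,
and on the complement B is definite, so it dominates B₁ there. -/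
theorem exists_lift_bound {E : Type*} [AddCommGroup E] [Module ℝ E] [FiniteDimensional ℝ E]
    (B B₁ : E →ₗ[ℝ] E →ₗ[ℝ] ℝ) (hs : ∀ x y, B x y = B y x) (h0 : ∀ x, 0 ≤ B x x) :
    ∃ C : ℝ, 0 < C ∧ ∀ x, ∃ y, B (x - y) (x - y) = 0 ∧ B₁ y y ≤ C * B x x := by
  obtain ⟨M, hM⟩ := (LinearMap.ker B).exists_isCompl
  have hker : ∀ x, B x x = 0 → B x = 0 := fun x hx => by
    refine LinearMap.ext fun y => ?_
    -- The quadratic t ↦ B (t x + y)(t x + y) has leading coefficient B x x = 0, so its nonpositive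
    -- discriminant is (2 B x y)².
    have h : ∀ t : ℝ, 0 ≤ 0 * (t * t) + (2 * B x y) * t + B y y := fun t => by
      have := h0 (t • x + y)
      simp only [map_add, map_smul, LinearMap.add_apply, LinearMap.smul_apply, smul_eq_mul, hx,
        hs y x] at this
      linarith
    have hd := discrim_le_zero h
    rw [discrim] at hd
    have : B x y ^ 2 = 0 := le_antisymm (by linarith) (sq_nonneg _)
    simpa using this
  obtain ⟨C, hC, h⟩ := exists_bound_of_posDef (E := M) (B.compl₁₂ M.subtype M.subtype)
    (B₁.compl₁₂ M.subtype M.subtype) (fun x y => hs _ _) (fun x => h0 _) (fun x hx => by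
      have h1 : (x : E) ∈ LinearMap.ker B := LinearMap.mem_ker.2 (hker _ hx)
      exact Subtype.ext (Submodule.disjoint_def.1 hM.disjoint _ h1 x.2))
  refine ⟨C, hC, fun x => ?_⟩
  obtain ⟨z, hz, y, hy, rfl⟩ := Submodule.mem_sup.1
    ((hM.sup_eq_top ▸ Submodule.mem_top : x ∈ LinearMap.ker B ⊔ M))
  rw [LinearMap.mem_ker] at hz
  refine ⟨y, by simp [hz], ?_⟩
  have h2 : B (z + y) (z + y) = B y y := by
    simp [hz, hs y z]
  rw [h2]
  exact h ⟨y, hy⟩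

/-! ### Bounded liftings of tangential traces. -/

theorem triNorm_nonneg {j : ℕ} (K : Finset (Euc n)) (s : TanField K j) : 0 ≤ triNorm K s :=
  mul_nonneg (Real.sqrt_nonneg _) (Real.sqrt_nonneg _)

theorem bdIp_self_nonneg {j : ℕ} (K : Finset (Euc n)) (s : TanField K j) : 0 ≤ bdIp K s s :=
  Finset.sum_nonneg fun _ _ => integral_nonneg fun _ => altInner_self_nonneg _ _ _

theorem cellDiam_nonneg (K : Finset (Euc n)) : 0 ≤ cellDiam K := Metric.diam_nonneg

theorem triNorm_sq {j : ℕ} (K : Finset (Euc n)) (s : TanField K j) :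
    triNorm K s ^ 2 = cellDiam K * bdIp K s s := by
  rw [triNorm, mul_pow, Real.sq_sqrt (cellDiam_nonneg K), Real.sq_sqrt (bdIp_self_nonneg K s)]

/-- On a fixed simplex, tangential traces have bounded liftings. -/
theorem IsSimplex.exists_lift {K : Finset (Euc n)} (hK : IsSimplex K) (hn : 0 < n) {m k : ℕ}
    (S : Submodule ℝ (Form n (k + 1))) (hS : S ≤ polyForms n m (k + 1)) :
    ∃ C : ℝ, 0 < C ∧ ∀ τ₀ ∈ S, ∃ τ ∈ S, facetIp K (τ₀ - τ) (τ₀ - τ) = 0 ∧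
      ip (cell K) τ τ + ip (cell K) (extD (k + 1) τ) (extD (k + 1) τ) ≤ C * facetIp K τ₀ τ₀ := by
  have hs : ∀ τ : S, ContDiff ℝ ∞ τ.1 := fun τ => contDiff_of_mem_polyForms (hS τ.2)
  have hc : ∀ τ : S, Continuous τ.1 := fun τ => (hs τ).continuous
  have hL : ∀ τ : S, MemL2 (cell K) τ.1 := fun τ => memL2_cell_of_continuous K (hc τ)
  have hdL : ∀ τ : S, MemL2 (cell K) (extD (k + 1) τ.1) := fun τ =>
    memL2_cell_of_continuous K (contDiff_of_mem_polyForms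
      (extD_mem_polyForms (polyForms_mono (Nat.le_succ m) _ (hS τ.2)))).continuous
  have : FiniteDimensional ℝ S := Submodule.finiteDimensional_of_le hS
  -- B is the boundary form, only semidefinite because trace-free forms lie in its kernel; B₁ below
  -- is the graph form of d.
  let B : S →ₗ[ℝ] S →ₗ[ℝ] ℝ := LinearMap.mk₂ ℝ (fun τ τ' => facetIp K τ.1 τ'.1)
    (fun τ τ' η => hK.facetIp_add_left hn (hc τ) (hc τ') (hc η))
    (fun c τ τ' => facetIp_smul_left K c _ _)
    (fun η τ τ' => by
      simp only [facetIp_comm K η.1]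
      exact hK.facetIp_add_left hn (hc τ) (hc τ') (hc η))
    (fun c τ τ' => by
      simp only [facetIp_comm K τ.1]
      exact facetIp_smul_left K c _ _)
  let B₁ : S →ₗ[ℝ] S →ₗ[ℝ] ℝ := LinearMap.mk₂ ℝ
    (fun τ τ' => ip (cell K) τ.1 τ'.1 + ip (cell K) (extD (k + 1) τ.1) (extD (k + 1) τ'.1))
    (fun τ τ' η => by
      rw [Submodule.coe_add, extD_add (hs τ) (hs τ'), ip_add_left (hL τ) (hL τ') (hL η),
        ip_add_left (hdL τ) (hdL τ') (hdL η)]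
      ring)
    (fun c τ τ' => by
      rw [Submodule.coe_smul, extD_smul, ip_smul_left, ip_smul_left, smul_eq_mul]
      ring)
    (fun η τ τ' => by
      rw [Submodule.coe_add, extD_add (hs τ) (hs τ'), ip_add_right (hL η) (hL τ) (hL τ'),
        ip_add_right (hdL η) (hdL τ) (hdL τ')]
      ring)
    (fun c τ τ' => by
      rw [Submodule.coe_smul, extD_smul, ip_smul_right, ip_smul_right, smul_eq_mul]
      ring)
  obtain ⟨C, hC, h⟩ := exists_lift_bound B B₁ (fun τ τ' => facetIp_comm K _ _)
    (fun τ => facetIp_self_nonneg K _)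
  refine ⟨C, hC, fun τ₀ h₀ => ?_⟩
  obtain ⟨τ, h1, h2⟩ := h ⟨τ₀, h₀⟩
  exact ⟨τ.1, τ.2, h1, h2⟩

/-- Tangential traces have liftings with uniformly bounded scaled norms on shape-regular
simplices. -/
theorem exists_uniform_lift_succ (hn : 0 < n) {m k : ℕ} (S : Submodule ℝ (Form n (k + 1)))
    (hS : S ≤ polyForms n m (k + 1))
    (hinv : ∀ (A : Euc n →L[ℝ] Euc n) (b : Euc n), ∀ v ∈ S, pullForm A b (k + 1) v ∈ S)
    {γ : ℝ} (hγ : 0 < γ) :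
    ∃ C : ℝ, 0 < C ∧ ∀ K : Finset (Euc n), IsSimplex K →
      (∃ c, Metric.ball c (cellDiam K / γ) ⊆ cell K) → ∀ τ₀ ∈ S, ∃ τ ∈ S,
        tanTrace K (k + 1) τ = tanTrace K (k + 1) τ₀ ∧
        nrm (cell K) τ ≤ C * triNorm K (tanTrace K (k + 1) τ₀) ∧
        cellDiam K * nrm (cell K) (extD (k + 1) τ) ≤ C * triNorm K (tanTrace K (k + 1) τ₀) := by
  -- Any one simplex serves as reference, which keeps the constant independent of K; if there is
  -- none, the claim is vacuous.
  by_cases hex : ∃ K₀ : Finset (Euc n), IsSimplex K₀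
  swap
  · exact ⟨1, one_pos, fun K hK => (hex ⟨K, hK⟩).elim⟩
  obtain ⟨K₀, hK₀⟩ := hex
  obtain ⟨C₀, hC₀, hlift⟩ := hK₀.exists_lift hn S hS
  obtain ⟨c₀, hc₀⟩ := hK₀.interior_cell_nonempty
  obtain ⟨ρ₀, hρ₀, hball₀⟩ := Metric.isOpen_iff.1 isOpen_interior c₀ hc₀
  -- These are the shape-regularity factors in ‖A‖ ≤ a₁ h and ‖A⁻¹‖ ≤ a₂ / h, where A is the linear
  -- part of the map from K₀ to K.
  set a₁ : ℝ := 2 / ρ₀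
  set a₂ : ℝ := 2 * cellDiam K₀ * γ
  have ha₁ : 0 < a₁ := by positivity
  have ha₂ : 0 < a₂ := by have := hK₀.cellDiam_pos hn; positivity
  -- C₁ and C₂ collect the two pullback constants, the reference constant C₀ and the powers of a₁,
  -- a₂ that survive the cancellation of h.
  set C₁ : ℝ := n ^ k * n ^ k * C₀ * (a₁ * a₂) ^ (2 * k) * a₁ ^ n * a₂ ^ (n - 1)
  set C₂ : ℝ := n ^ (k + 1) * n ^ k * C₀ * (a₁ * a₂) ^ (2 * k) * a₁ ^ n * a₂ ^ (n - 1) * a₂ ^ 2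
  have hC₁ : 0 ≤ C₁ := by positivity
  have hC₂ : 0 ≤ C₂ := by positivity
  refine ⟨√C₁ + √C₂ + 1, by positivity, fun K hK ⟨c, hc⟩ τ₀ hτ₀ => ?_⟩
  obtain ⟨A, b, hAb⟩ := hK₀.exists_affHomeo_image hK
  have hcell : affHomeo A b '' cell K₀ = cell K := by
    rw [cell, affHomeo_image_convexHull, hAb]; rfl
  have hinvmap : ∀ x, affHomeo A.symm (-A.symm b) x = (affHomeo A b).symm x := fun x => by
    rw [affHomeo_symm_apply]; rfl
  have hAb' : affHomeo A.symm (-A.symm b) '' (K : Set (Euc n)) = (K₀ : Set (Euc n)) := by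
    rw [← hAb, Set.image_image]
    simp [hinvmap]
  have hcell' : affHomeo A.symm (-A.symm b) '' cell K = cell K₀ := by
    rw [cell, affHomeo_image_convexHull, hAb']; rfl
  set h : ℝ := cellDiam K
  have hh : 0 < h := hK.cellDiam_pos hn
  set NA : ℝ := ‖(A : Euc n →L[ℝ] Euc n)‖
  set NB : ℝ := ‖(A.symm : Euc n →L[ℝ] Euc n)‖
  have hNA0 : 0 ≤ NA := norm_nonneg _
  have hNB0 : 0 ≤ NB := norm_nonneg _
  have hNA : NA ≤ a₁ * h := by
    refine (norm_le_of_ball_subset A b (isCompact_cell K).isBounded hcell.subset hρ₀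
      (hball₀.trans interior_subset)).trans_eq ?_
    change 2 * h / ρ₀ = _
    simp only [a₁]; ring
  have hNB : NB ≤ a₂ / h := by
    refine (norm_le_of_ball_subset A.symm (-A.symm b) (isCompact_cell K₀).isBounded hcell'.subset
      (by positivity) hc).trans_eq ?_
    change 2 * cellDiam K₀ / (h / γ) = _
    simp only [a₂]; field_simp
  have hcont : ∀ η ∈ S, Continuous η := fun η hη => (contDiff_of_mem_polyForms (hS hη)).continuous
  set η₀ := pullForm (A : Euc n →L[ℝ] Euc n) b (k + 1) τ₀
  have hη₀ : η₀ ∈ S := hinv _ _ _ hτ₀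
  obtain ⟨η, hη, hker, hbd⟩ := hlift η₀ hη₀
  set τ := pullForm (A.symm : Euc n →L[ℝ] Euc n) (-A.symm b) (k + 1) η
  have hτ : τ ∈ S := hinv _ _ _ hη
  have hback : pullForm (A.symm : Euc n →L[ℝ] Euc n) (-A.symm b) (k + 1) η₀ = τ₀ := by
    funext x
    refine ContinuousAlternatingMap.ext fun v => ?_
    change (τ₀ (A (A.symm x + -A.symm b) + b)).form (fun i => A (A.symm (v i))) = (τ₀ x).form v
    simp
  -- The difference η₀ - η has zero boundary norm on K₀; pulled back to K it becomes τ₀ - τ, still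
  -- of zero boundary norm.
  have htr : tanTrace K (k + 1) τ = tanTrace K (k + 1) τ₀ := by
    have h1 := hK.facetIp_pullForm_le hK₀ hn A.symm (-A.symm b) hAb' k
      (τ := η₀ - η) ((hcont _ hη₀).sub (hcont _ hη))
    rw [hker, mul_zero, mul_zero, map_sub, hback] at h1
    have h2 := hK.tanTrace_eq_zero hn (τ := τ₀ - τ) ((hcont _ hτ₀).sub (hcont _ hτ))
      (le_antisymm h1 (facetIp_self_nonneg K _))
    rw [map_sub, sub_eq_zero] at h2
    exact h2.symm
  set β := facetIp K τ₀ τ₀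
  have hβ : 0 ≤ β := facetIp_self_nonneg K τ₀
  have hfac : facetIp K₀ η₀ η₀ ≤ n ^ k * ((a₁ * h) ^ 2) ^ k * ((a₂ / h) ^ (n - 1) * β) := by
    refine (hK₀.facetIp_pullForm_le hK hn A b hAb k (hcont _ hτ₀)).trans ?_
    gcongr
  have hηη := ip_self_nonneg (cell K₀) η
  have hdd := ip_self_nonneg (cell K₀) (extD (k + 1) η)
  have htri : triNorm K (tanTrace K (k + 1) τ₀) = √(h * β) := by
    rw [← Real.sqrt_sq (triNorm_nonneg K (tanTrace K (k + 1) τ₀)), triNorm_sq, bdIp_tanTrace]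
  have hn1 : n = n - 1 + 1 := by omega
  -- Power counting: the factors from the form degree cancel between pulling back and forth, volume
  -- gives h ^ n and facets h ^ (1 - n), so exactly one h is left, the weight in `triNorm` squared.
  have e1 : (a₂ / h) ^ (2 * k) * (a₁ * h) ^ n * ((a₁ * h) ^ (2 * k) * (a₂ / h) ^ (n - 1)) =
      (a₁ * a₂) ^ (2 * k) * a₁ ^ n * a₂ ^ (n - 1) * h := by
    have e2 : (a₂ / h) ^ (2 * k) * (a₁ * h) ^ (2 * k) = (a₁ * a₂) ^ (2 * k) := by
      rw [← mul_pow]; congr 1; field_simp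
    have e3 : (a₁ * h) ^ n * (a₂ / h) ^ (n - 1) = a₁ ^ n * a₂ ^ (n - 1) * h := by
      rw [mul_pow, div_pow]
      have : h ^ n = h ^ (n - 1) * h := by rw [← pow_succ, ← hn1]
      rw [this]
      field_simp
      rw [← mul_pow]
      congr 1
      field_simp
    linear_combination (a₁ * h) ^ n * (a₂ / h) ^ (n - 1) * e2 + (a₁ * a₂) ^ (2 * k) * e3
  have hcompact := isCompact_cell K
  have hip : ip (cell K) τ τ ≤ C₁ * (h * β) := by
    have h1 := ip_pullForm_le A.symm (-A.symm b) hcompact k (hcont _ hη)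
    rw [hcell'] at h1
    refine h1.trans ?_
    calc _ ≤ n ^ k * ((a₂ / h) ^ 2) ^ k * ((a₁ * h) ^ n *
          (C₀ * (n ^ k * ((a₁ * h) ^ 2) ^ k * ((a₂ / h) ^ (n - 1) * β)))) := by
          gcongr
          · exact hNA
          · refine le_trans ?_ (hbd.trans (mul_le_mul_of_nonneg_left hfac hC₀.le))
            linarith
      _ = _ := by
          rw [← pow_mul, ← pow_mul]
          simp only [C₁]
          linear_combination n ^ k * n ^ k * C₀ * β * e1
  have hdτ : extD (k + 1) τ =
      pullForm (A.symm : Euc n →L[ℝ] Euc n) (-A.symm b) (k + 2) (extD (k + 1) η) :=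
    extD_pullForm _ _ (contDiff_of_mem_polyForms (hS hη))
  have hdc : Continuous (extD (k + 1) η) := (contDiff_of_mem_polyForms
    (extD_mem_polyForms (polyForms_mono (Nat.le_succ m) _ (hS hη)))).continuous
  -- The derivative has one degree more, which costs an extra (a₂ / h)² and is compensated by the
  -- factor h².
  have hipd : h ^ 2 * ip (cell K) (extD (k + 1) τ) (extD (k + 1) τ) ≤ C₂ * (h * β) := by
    have h1 := ip_pullForm_le A.symm (-A.symm b) hcompact (k + 1) hdc
    rw [hcell', ← hdτ] at h1
    calc _ ≤ h ^ 2 * (n ^ (k + 1) * ((a₂ / h) ^ 2) ^ (k + 1) * ((a₁ * h) ^ n *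
          (C₀ * (n ^ k * ((a₁ * h) ^ 2) ^ k * ((a₂ / h) ^ (n - 1) * β))))) := by
          refine mul_le_mul_of_nonneg_left (h1.trans ?_) (by positivity)
          gcongr
          · exact hNA
          · refine le_trans ?_ (hbd.trans (mul_le_mul_of_nonneg_left hfac hC₀.le))
            linarith
      _ = _ := by
          rw [pow_succ ((a₂ / h) ^ 2), ← pow_mul, ← pow_mul]
          simp only [C₂]
          have e4 : h ^ 2 * (a₂ / h) ^ 2 = a₂ ^ 2 := by field_simp
          linear_combination n ^ (k + 1) * n ^ k * C₀ * β * h ^ 2 * (a₂ / h) ^ 2 * e1 +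
            n ^ (k + 1) * n ^ k * C₀ * β * (a₁ * a₂) ^ (2 * k) * a₁ ^ n * a₂ ^ (n - 1) * h * e4
  have hr := Real.sqrt_nonneg (h * β)
  refine ⟨τ, hτ, htr, ?_, ?_⟩
  · rw [htri]
    calc nrm (cell K) τ ≤ √(C₁ * (h * β)) := Real.sqrt_le_sqrt hip
      _ = √C₁ * √(h * β) := Real.sqrt_mul hC₁ _
      _ ≤ _ := by gcongr; linarith [Real.sqrt_nonneg C₂]
  · rw [htri]
    calc h * nrm (cell K) (extD (k + 1) τ) =
          √(h ^ 2 * ip (cell K) (extD (k + 1) τ) (extD (k + 1) τ)) := by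
          rw [Real.sqrt_mul (by positivity), Real.sqrt_sq hh.le]; rfl
      _ ≤ √(C₂ * (h * β)) := Real.sqrt_le_sqrt hipd
      _ = √C₂ * √(h * β) := Real.sqrt_mul hC₂ _
      _ ≤ _ := by gcongr; linarith [Real.sqrt_nonneg C₁]

theorem exists_uniform_lift (hn : 0 < n) {m j : ℕ} (S : Submodule ℝ (Form n j))
    (hS : S ≤ polyForms n m j)
    (hinv : ∀ (A : Euc n →L[ℝ] Euc n) (b : Euc n), ∀ v ∈ S, pullForm A b j v ∈ S)
    {γ : ℝ} (hγ : 0 < γ) :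
    ∃ C : ℝ, 0 < C ∧ ∀ K : Finset (Euc n), IsSimplex K →
      (∃ c, Metric.ball c (cellDiam K / γ) ⊆ cell K) → ∀ s ∈ tanSpace K S, ∃ τ ∈ S,
        tanTrace K j τ = s ∧ nrm (cell K) τ ≤ C * triNorm K s ∧
        cellDiam K * nrm (cell K) (extD j τ) ≤ C * triNorm K s := by
  cases j with
  | zero =>
      -- In shifted degree 0 the forms are (-1)-forms and both norms vanish, so any positive
      -- constant works.
      refine ⟨1, one_pos, fun K _ _ s hs => ?_⟩
      obtain ⟨τ, hτ, rfl⟩ := hs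
      have h0 : nrm (cell K) τ = 0 := by simp [nrm, ip, altInner]
      have h1 : nrm (cell K) (extD 0 τ) = 0 := by simp [extD_zero_degree, nrm]
      have := triNorm_nonneg K (tanTrace K 0 τ)
      exact ⟨τ, hτ, rfl, by rw [h0]; linarith, by rw [h1]; linarith⟩
  | succ k =>
      obtain ⟨C, hC, h⟩ := exists_uniform_lift_succ hn S hS hinv hγ
      refine ⟨C, hC, fun K hK hb s hs => ?_⟩
      obtain ⟨τ₀, hτ₀, rfl⟩ := hs
      exact h K hK hb τ₀ hτ₀

/-! Integration by parts for forms -/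

/-- Antisymmetrization is adjoint to contraction. Splitting an index map into its value at position
p and the rest, and moving the inserted vector to the front to absorb the sign, shows that all k + 1
positions contribute equally; the factor k + 1 turns 1/(k+1)! into 1/k!. -/
theorem altInner_skew (k : ℕ) (F : Euc n →L[ℝ] Alt (Euc n) (k + 1)) (η : Alt (Euc n) (k + 2)) :
    altInner (fun i : Fin n => EuclideanSpace.single i (1 : ℝ)) (k + 2) (skew n k F) η =
      ∑ l : Fin n, altInner (fun i : Fin n => EuclideanSpace.single i (1 : ℝ)) (k + 1)
        (F (EuclideanSpace.single l 1)) (contract (EuclideanSpace.single l (1 : ℝ)) (k + 1) η) := by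
  set e : Fin n → Euc n := fun i => EuclideanSpace.single i (1 : ℝ)
  have hsk : ∀ v : Fin (k + 1) → Euc n, (skew n k F).form v =
      ∑ p : Fin (k + 1), (-1) ^ (p : ℕ) * (F (v p)).form (p.removeNth v) := fun v => by
    refine (ContinuousAlternatingMap.alternatizeUncurryFin_apply _ v).trans ?_
    refine Finset.sum_congr rfl fun p _ => ?_
    rw [zsmul_eq_mul]
    push_cast
    rfl
  have hins : ∀ (p : Fin (k + 1)) (x : Euc n) (v : Fin k → Euc n),
      (-1) ^ (p : ℕ) * η.form (p.insertNth x v) = η.form (Matrix.vecCons x v) := fun p x v => by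
    have := η.form.neg_one_pow_smul_map_insertNth p x v
    rw [zsmul_eq_mul] at this
    push_cast at this
    exact this
  have hL : altInner e (k + 2) (skew n k F) η = (((k + 1).factorial : ℝ))⁻¹ *
      ∑ I : Fin (k + 1) → Fin n, (skew n k F).form (fun i => e (I i)) * η.form fun i => e (I i) :=
    rfl
  have hR : ∀ l, altInner e (k + 1) (F (e l)) (contract (e l) (k + 1) η) =
      ((k.factorial : ℝ))⁻¹ * ∑ I : Fin k → Fin n, (F (e l)).form (fun i => e (I i)) *
        η.form (Matrix.vecCons (e l) fun i => e (I i)) := fun l => rfl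
  have hp : ∀ p : Fin (k + 1), ∑ I : Fin (k + 1) → Fin n,
      (-1) ^ (p : ℕ) * (F (e (I p))).form (p.removeNth fun i => e (I i)) *
        η.form (fun i => e (I i)) = ∑ l, ∑ I : Fin k → Fin n, (F (e l)).form (fun i => e (I i)) *
        η.form (Matrix.vecCons (e l) fun i => e (I i)) := fun p => by
    rw [← (Fin.insertNthEquiv (fun _ => Fin n) p).sum_comp, Fintype.sum_prod_type]
    refine Finset.sum_congr rfl fun l _ => Finset.sum_congr rfl fun I _ => ?_
    have h1 : (fun i => e ((Fin.insertNthEquiv (fun _ => Fin n) p) (l, I) i)) =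
        p.insertNth (α := fun _ => Euc n) (e l) fun i => e (I i) := by
      funext i
      refine Fin.succAboveCases p ?_ (fun i => ?_) i <;> simp
    rw [h1, Fin.removeNth_insertNth]
    simp only [Fin.insertNthEquiv_apply, Fin.insertNth_apply_same]
    rw [← hins p]
    ring
  rw [hL]
  simp only [hsk, Finset.sum_mul]
  rw [Finset.sum_comm, Finset.sum_congr rfl fun p _ => hp p, Finset.sum_const,
    Finset.sum_congr rfl fun l _ => hR l, ← Finset.mul_sum, Finset.card_univ, Fintype.card_fin,
    nsmul_eq_mul, Nat.factorial_succ]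
  push_cast
  field_simp

theorem altInner_extD (j : ℕ) (τ : Form n j) (x : Euc n) (η : Alt (Euc n) (j + 1)) :
    altInner (fun i : Fin n => EuclideanSpace.single i (1 : ℝ)) (j + 1) (extD j τ x) η =
      ∑ l : Fin n, altInner (fun i : Fin n => EuclideanSpace.single i (1 : ℝ)) j
        (fderiv ℝ τ x (EuclideanSpace.single l 1))
        (contract (EuclideanSpace.single l (1 : ℝ)) j η) := by
  cases j with
  | zero =>
      have : extD 0 τ x = 0 := rfl
      rw [this, altInner_zero_left]
      simp [altInner]
  | succ k => rw [extD_eq, altInner_skew]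

theorem continuous_extD {j : ℕ} {τ : Form n j} (hτ : ContDiff ℝ ∞ τ) : Continuous (extD j τ) := by
  cases j with
  | zero => exact continuous_const (y := (0 : Alt (Euc n) 1))
  | succ k =>
      have := (skew n k).continuous_of_finiteDimensional.comp (hτ.continuous_fderiv (by simp))
      exact this

theorem extD_eq_zero_of_notMem_tsupport {j : ℕ} {τ : Form n j} {x : Euc n}
    (hx : x ∉ tsupport τ) : extD j τ x = 0 := by
  cases j with
  | zero => rfl
  | succ k => rw [extD_eq, fderiv_of_notMem_tsupport ℝ hx, map_zero]

theorem hasCompactSupport_extD {j : ℕ} {τ : Form n j} (hτ : HasCompactSupport τ) :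
    HasCompactSupport (extD j τ) :=
  HasCompactSupport.intro hτ fun _ hx => extD_eq_zero_of_notMem_tsupport hx

theorem ip_eq_integral_of_right {j : ℕ} {U : Set (Euc n)} (α : Form n j) {β : Form n j}
    (h : ∀ x ∉ U, β x = 0) : ip U α β =
      ∫ x, altInner (fun i : Fin n => EuclideanSpace.single i (1 : ℝ)) j (α x) (β x) :=
  setIntegral_eq_integral_of_forall_compl_eq_zero fun x hx => by rw [h x hx, altInner_zero_right]

theorem ip_eq_of_subset {j : ℕ} {U U' : Set (Euc n)} (hU : U ⊆ U') (α : Form n j) {β : Form n j}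
    (h : ∀ x ∉ U, β x = 0) : ip U' α β = ip U α β := by
  rw [ip_eq_integral_of_right α h, ip_eq_integral_of_right α fun x hx => h x fun hx' => hx (hU hx')]

theorem IsTest.eq_zero {j : ℕ} {U : Set (Euc n)} {τ : Form n j} (hτ : IsTest U τ) {x : Euc n}
    (hx : x ∉ U) : τ x = 0 := image_eq_zero_of_notMem_tsupport fun h => hx (hτ.2.2 h)

theorem IsTest.extD_eq_zero {j : ℕ} {U : Set (Euc n)} {τ : Form n j} (hτ : IsTest U τ) {x : Euc n}
    (hx : x ∉ U) : extD j τ x = 0 := extD_eq_zero_of_notMem_tsupport fun h => hx (hτ.2.2 h)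

theorem IsTest.mono {j : ℕ} {U U' : Set (Euc n)} (hU : U ⊆ U') {τ : Form n j}
    (hτ : IsTest U τ) : IsTest U' τ := ⟨hτ.1, hτ.2.1, hτ.2.2.trans hU⟩

theorem memL2_of_hasCompactSupport {j : ℕ} (U : Set (Euc n)) {τ : Form n j} (hc : Continuous τ)
    (hs : HasCompactSupport τ) : MemL2 U τ :=
  (hc.memLp_of_hasCompactSupport hs).restrict U

/-- After writing d as a sum of contractions against partial derivatives, this is integration by
parts in each coordinate direction. Compact support of η alone removes the boundary terms. -/
theorem integral_altInner_extD {j : ℕ} {τ : Form n j} {η : Form n (j + 1)} (hτ : ContDiff ℝ ∞ τ)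
    (hη : ContDiff ℝ ∞ η) (hηc : HasCompactSupport η) :
    ∫ x, altInner (fun i : Fin n => EuclideanSpace.single i (1 : ℝ)) (j + 1) (extD j τ x) (η x) =
      ∫ x, altInner (fun i : Fin n => EuclideanSpace.single i (1 : ℝ)) j (τ x) (codiff j η x) := by
  set e : Fin n → Euc n := fun i => EuclideanSpace.single i (1 : ℝ)
  let B : Fin n → Alt (Euc n) j →L[ℝ] Alt (Euc n) (j + 1) →L[ℝ] ℝ := fun l =>
    LinearMap.toContinuousLinearMap
      ((LinearMap.toContinuousLinearMap (𝕜 := ℝ) (E := Alt (Euc n) (j + 1)) (F' := ℝ)).toLinearMap.comp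
        ((altBilin e j).compl₂ (contract (e l) j)))
  have hdτ : ∀ l, Continuous fun x => fderiv ℝ τ x (e l) := fun l =>
    (hτ.continuous_fderiv (by simp)).clm_apply continuous_const
  have hdη : ∀ l, Continuous fun x => fderiv ℝ η x (e l) := fun l =>
    (hη.continuous_fderiv (by simp)).clm_apply continuous_const
  have hcont : ∀ l {α : Form n j} {β : Form n (j + 1)}, Continuous α → Continuous β →
      Continuous fun x => B l (α x) (β x) := fun l _ _ hα hβ =>
    ((B l).continuous.comp hα).clm_apply hβ
  have i1 : ∀ l, Integrable fun x => B l (fderiv ℝ τ x (e l)) (η x) := fun l =>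
    (hcont l (hdτ l) hη.continuous).integrable_of_hasCompactSupport
      (HasCompactSupport.intro hηc fun x hx => by
        rw [image_eq_zero_of_notMem_tsupport hx, map_zero])
  have i2 : ∀ l, Integrable fun x => B l (τ x) (fderiv ℝ η x (e l)) := fun l =>
    (hcont l hτ.continuous (hdη l)).integrable_of_hasCompactSupport
      (HasCompactSupport.intro hηc fun x hx => by
        rw [fderiv_of_notMem_tsupport ℝ hx]; simp)
  have i3 : ∀ l, Integrable fun x => B l (τ x) (η x) := fun l =>
    (hcont l hτ.continuous hη.continuous).integrable_of_hasCompactSupport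
      (HasCompactSupport.intro hηc fun x hx => by
        rw [image_eq_zero_of_notMem_tsupport hx, map_zero])
  have i4 : ∀ l, Integrable fun x => -B l (τ x) (fderiv ℝ η x (e l)) := fun l => (i2 l).neg
  have hl : ∀ x, altInner e (j + 1) (extD j τ x) (η x) =
      ∑ l, B l (fderiv ℝ τ x (e l)) (η x) := fun x => altInner_extD j τ x (η x)
  have hr : ∀ x, altInner e j (τ x) (codiff j η x) = ∑ l, -B l (τ x) (fderiv ℝ η x (e l)) :=
    fun x => by
      change altBilin e j (τ x) (-∑ l, contract (e l) j (fderiv ℝ η x (e l))) = _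
      rw [map_neg, map_sum, Finset.sum_neg_distrib]
      rfl
  simp only [hl, hr]
  rw [integral_finsetSum _ fun l _ => i1 l, integral_finsetSum _ fun l _ => i4 l]
  refine Finset.sum_congr rfl fun l _ => ?_
  rw [integral_neg, integral_bilinear_fderiv_right_eq_neg_left_of_integrable (i1 l) (i2 l) (i3 l)
    (fun x _ => hτ.differentiable (by simp) x) (fun x _ => hη.differentiable (by simp) x), neg_neg]

/-- The classical exterior derivative of a test form is its weak exterior derivative. -/
theorem IsTest.isWeakD {j : ℕ} {U : Set (Euc n)} {τ : Form n j} (hτ : IsTest U τ) :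
    IsWeakD U τ (extD j τ) := by
  refine ⟨memL2_of_hasCompactSupport U hτ.1.continuous hτ.2.1,
    memL2_of_hasCompactSupport U (continuous_extD hτ.1) (hasCompactSupport_extD hτ.2.1),
    fun η hη => ?_⟩
  rw [ip_eq_integral_of_right _ fun x hx => hη.eq_zero hx, ip_comm,
    ip_eq_integral_of_right _ fun x hx => hτ.eq_zero hx,
    integral_altInner_extD hτ.1 hη.1 hη.2.1]
  simp only [altInner_comm _ j (τ _)]

/-- A square integrable form is determined by its pairings with test forms. -/
theorem ae_eq_of_forall_isTest {j : ℕ} {U : Set (Euc n)} (hU : IsOpen U) {w w' : Form n j}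
    (hw : MemL2 U w) (hw' : MemL2 U w') (h : ∀ τ : Form n j, IsTest U τ → ip U τ w = ip U τ w') :
    w =ᵐ[volume.restrict U] w' := by
  have hL : MemL2 U (w - w') := MemLp.sub hw hw'
  have hloc : LocallyIntegrable (w - w') (volume.restrict U) := MemLp.locallyIntegrable hL (by norm_num)
  have key := hU.ae_eq_zero_of_integral_contDiff_smul_eq_zero (f := w - w') (μ := volume)
    (locallyIntegrableOn_of_locallyIntegrable_restrict hloc) fun g hg hgc hgs => by
      have hg0 : ∀ x ∉ U, g x = 0 := fun x hx =>
        image_eq_zero_of_notMem_tsupport fun h => hx (hgs h)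
      rw [← setIntegral_eq_integral_of_forall_compl_eq_zero (s := U)
        fun x hx => by rw [hg0 x hx, zero_smul]]
      have hint : Integrable (fun x => g x • (w - w') x) (volume.restrict U) :=
        hloc.integrable_smul_left_of_hasCompactSupport hg.continuous hgc
      set I := ∫ x in U, g x • (w - w') x
      -- The integral I is an alternating form; testing with the constant form I multiplied by the
      -- bump g gives ⟨I, I⟩ = (g I, w - w') = 0.
      refine eq_zero_of_altInner_self (EuclideanSpace.basisFun (Fin n) ℝ) j I ?_
      rw [← altInner_single]
      let L : Alt (Euc n) j →L[ℝ] ℝ := LinearMap.toContinuousLinearMap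
        (altBilin (fun i : Fin n => EuclideanSpace.single i (1 : ℝ)) j I)
      have h1 : L I = ∫ x in U, L (g x • (w - w') x) := (L.integral_comp_comm hint).symm
      change L I = 0
      have ht : IsTest U fun x => g x • I := by
        refine ⟨hg.smul contDiff_const, hgc.smul_right, ?_⟩
        exact (tsupport_smul_subset_left g fun _ => I).trans hgs
      have h2 : ip U (fun x => g x • I) (w - w') = 0 := by
        have hm := memL2_of_hasCompactSupport U ht.1.continuous ht.2.1
        rw [ip_comm, ip_sub_left hw hw' hm, ip_comm U w, ip_comm U w', h _ ht, sub_self]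
      rw [h1, ← h2]
      refine integral_congr_ae (Filter.Eventually.of_forall fun x => ?_)
      change altBilin _ j I (g x • (w - w') x) = altInner _ j (g x • I) ((w - w') x)
      rw [map_smul, altInner_smul_left]
      rfl
  have := (ae_restrict_iff' hU.measurableSet).2 key
  filter_upwards [this] with x hx
  exact sub_eq_zero.1 hx

/-! Simplices of a triangulation -/

/-- The frontier of a convex set is null. This links weak derivatives, posed on the open simplex,
with inner products over the closed one. -/
theorem restrict_interior_cell (K : Finset (Euc n)) :
    (volume : Measure (Euc n)).restrict (interior (cell K)) = volume.restrict (cell K) :=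
  Measure.restrict_congr_set (interior_ae_eq_of_null_frontier
    ((convex_cell K).addHaar_frontier volume))

theorem memL2_interior_cell {j : ℕ} {K : Finset (Euc n)} {α : Form n j} :
    MemL2 (interior (cell K)) α ↔ MemL2 (cell K) α := by
  rw [MemL2, MemL2, restrict_interior_cell]

theorem IsTriangulation.isSimplex {Ω : Set (Euc n)} {T : Finset (Finset (Euc n))}
    (hT : IsTriangulation Ω T) {K : Finset (Euc n)} (hK : K ∈ T) : IsSimplex K := by
  obtain ⟨𝒦, h𝒦, -⟩ := hT.exists_complex
  have : K ∈ 𝒦.facets := by rw [h𝒦]; exact hK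
  exact ⟨𝒦.indep (𝒦.facets_subset this), hT.card_eq K hK⟩

theorem IsTriangulation.interior_cell_subset {Ω : Set (Euc n)} {T : Finset (Finset (Euc n))}
    (hT : IsTriangulation Ω T) {K : Finset (Euc n)} (hK : K ∈ T) : interior (cell K) ⊆ Ω := by
  obtain ⟨𝒦, h𝒦, rfl⟩ := hT.exists_complex
  have : K ∈ 𝒦.facets := by rw [h𝒦]; exact hK
  exact interior_mono (𝒦.convexHull_subset_space (𝒦.facets_subset this))

theorem IsTriangulation.memL2_cell {Ω : Set (Euc n)} {T : Finset (Finset (Euc n))}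
    (hT : IsTriangulation Ω T) {K : Finset (Euc n)} (hK : K ∈ T) {j : ℕ} {α : Form n j}
    (hα : MemL2 Ω α) : MemL2 (cell K) α :=
  memL2_interior_cell.1 (MemLp.mono_measure
    (Measure.restrict_mono (hT.interior_cell_subset hK) le_rfl) hα)

/-! ### Localization of broken equations to one simplex. -/

open Classical in
/-- The broken form which is `τ` on `K` and vanishes on all other simplices. -/
def brokenSingle {j : ℕ} (K : Finset (Euc n)) (τ : Form n j) : Broken n j :=
  fun L => if L = K then τ else 0

theorem brokenSingle_same {j : ℕ} (K : Finset (Euc n)) (τ : Form n j) :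
    brokenSingle K τ K = τ := if_pos rfl

theorem brokenSingle_of_ne {j : ℕ} {K L : Finset (Euc n)} (h : L ≠ K) (τ : Form n j) :
    brokenSingle K τ L = 0 := if_neg h

theorem bD_brokenSingle {j : ℕ} (K : Finset (Euc n)) (τ : Form n j) :
    bD (brokenSingle K τ) = brokenSingle K (extD j τ) := by
  funext L
  by_cases h : L = K
  · subst h; rw [bD, brokenSingle_same, brokenSingle_same]
  · rw [bD, brokenSingle_of_ne h, brokenSingle_of_ne h, extD_zero]

theorem memW_brokenSingle {j : ℕ} (T : Finset (Finset (Euc n))) {S : Submodule ℝ (Form n j)}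
    (K : Finset (Euc n)) {τ : Form n j} (hτ : τ ∈ S) : MemW T S (brokenSingle K τ) := fun L _ => by
  by_cases h : L = K
  · subst h; rwa [brokenSingle_same]
  · rw [brokenSingle_of_ne h]; exact S.zero_mem

theorem bip_brokenSingle {j : ℕ} {T : Finset (Finset (Euc n))} {K : Finset (Euc n)} (hK : K ∈ T)
    (α : Broken n j) (τ : Form n j) : bip T α (brokenSingle K τ) = ip (cell K) (α K) τ := by
  rw [bip, Finset.sum_eq_single_of_mem K hK fun L _ h => by
    rw [brokenSingle_of_ne h, ip_zero_right], brokenSingle_same]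

theorem bdIp_zero_right {j : ℕ} (K : Finset (Euc n)) (s : TanField K j) : bdIp K s 0 = 0 :=
  Finset.sum_eq_zero fun v _ => by
    have : ∀ x, altInner (stdOrthonormalBasis ℝ (facetDir K v)) j (s v x)
      ((0 : TanField K j) v x) = 0 := fun x => altInner_zero_right _ _ _
    simp only [this, integral_zero]

theorem bbdIp_brokenSingle {j : ℕ} {T : Finset (Finset (Euc n))} {K : Finset (Euc n)} (hK : K ∈ T)
    (s : BrokenTan n j) (τ : Form n j) :
    bbdIp T s (bTan (brokenSingle K τ)) = bdIp K (s K) (tanTrace K j τ) := by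
  rw [bbdIp, Finset.sum_eq_single_of_mem K hK fun L _ h => by
    rw [bTan, brokenSingle_of_ne h, map_zero, bdIp_zero_right], bTan, brokenSingle_same]

theorem sum_traceDuality_brokenSingle {j : ℕ} {T : Finset (Finset (Euc n))} {K : Finset (Euc n)}
    (hK : K ∈ T) (τ : Form n j) (v : Form n (j + 1)) (δv : Broken n j) :
    ∑ L ∈ T, traceDuality L (brokenSingle K τ L) (extD j (brokenSingle K τ L)) v (δv L) =
      traceDuality K τ (extD j τ) v (δv K) := by
  rw [Finset.sum_eq_single_of_mem K hK fun L _ h => by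
    rw [brokenSingle_of_ne h, extD_zero, traceDuality, ip_zero_left, ip_zero_left, sub_zero],
    brokenSingle_same]

theorem IsSimplex.bdIp_sub_left {K : Finset (Euc n)} (hK : IsSimplex K) (hn : 0 < n) {m j : ℕ}
    {S : Submodule ℝ (Form n j)} (hS : S ≤ polyForms n m j) {s s' : TanField K j}
    (hs : s ∈ tanSpace K S) (hs' : s' ∈ tanSpace K S) {τ : Form n j} (hτ : τ ∈ S) :
    bdIp K (s - s') (tanTrace K j τ) =
      bdIp K s (tanTrace K j τ) - bdIp K s' (tanTrace K j τ) := by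
  obtain ⟨a, ha, rfl⟩ := hs
  obtain ⟨b, hb, rfl⟩ := hs'
  have hc : ∀ {η : Form n j}, η ∈ S → Continuous η := fun hη =>
    (contDiff_of_mem_polyForms (hS hη)).continuous
  rw [← map_sub, bdIp_tanTrace, bdIp_tanTrace, bdIp_tanTrace, eq_sub_iff_add_eq,
    ← hK.facetIp_add_left hn ((hc ha).sub (hc hb)) (hc hb) (hc hτ), sub_add_cancel]

/-- The lifting argument: a trace whose pairings with all discrete traces are controlled is
controlled itself. -/
theorem triNorm_le_of_pairing {j : ℕ} {K : Finset (Euc n)} {S : Submodule ℝ (Form n j)}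
    {s : TanField K j} {C : ℝ} (hC : 0 ≤ C)
    (hlift : ∃ τ ∈ S, tanTrace K j τ = s ∧ nrm (cell K) τ ≤ C * triNorm K s ∧
        cellDiam K * nrm (cell K) (extD j τ) ≤ C * triNorm K s) {E G : ℝ} (hE : 0 ≤ E)
    (hG : 0 ≤ G) (h : ∀ τ ∈ S, bdIp K s (tanTrace K j τ) ≤
      nrm (cell K) (extD j τ) * E + nrm (cell K) τ * G) :
    triNorm K s ≤ C * (E + cellDiam K * G) := by
  obtain ⟨τ, hτ, hs, h1, h2⟩ := hlift
  have hd := cellDiam_nonneg K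
  have h3 : triNorm K s ^ 2 ≤ triNorm K s * (C * (E + cellDiam K * G)) := by
    have h4 := h τ hτ
    rw [hs] at h4
    -- The trace is paired with its own lifting; the weight h_K goes to dτ in one term and to G in
    -- the other, after which one factor `triNorm K s` is cancelled.
    calc triNorm K s ^ 2 = cellDiam K * bdIp K s s := triNorm_sq K s
      _ ≤ cellDiam K * (nrm (cell K) (extD j τ) * E + nrm (cell K) τ * G) := by gcongr
      _ = cellDiam K * nrm (cell K) (extD j τ) * E + nrm (cell K) τ * (cellDiam K * G) := by ring
      _ ≤ C * triNorm K s * E + C * triNorm K s * (cellDiam K * G) := by gcongr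
      _ = _ := by ring
  rcases (triNorm_nonneg K s).eq_or_lt with h0 | h0
  · rw [← h0]; positivity
  · rw [sq] at h3
    exact le_of_mul_le_mul_left h3 h0

/-! ### Codifferentials of the exact solution on a simplex. -/

section Exact

variable {Ω : Set (Euc n)} {T : Finset (Finset (Euc n))} {j : ℕ} {f : Form n (j + 1)}
  {σ : Form n j} {dσ u : Form n (j + 1)} {du : Form n (j + 2)} {p : Form n (j + 1)}

/-- `σ` is the weak codifferential of `u` on each simplex. -/
theorem HodgeLaplaceSolution.codiff_u (hsol : HodgeLaplaceSolution Ω f σ dσ u du p)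
    (hT : IsTriangulation Ω T) {K : Finset (Euc n)} (hK : K ∈ T) {w : Form n j}
    (hw : IsWeakCodiff (interior (cell K)) u w) : w =ᵐ[volume.restrict (interior (cell K))] σ := by
  have hU := hT.interior_cell_subset hK
  refine ae_eq_of_forall_isTest isOpen_interior hw.2.1
    (memL2_interior_cell.2 (hT.memL2_cell hK hsol.sigma_mem.1)) fun τ hτ => ?_
  -- A form supported inside the simplex is admissible in the global equation on Ω, which then
  -- reduces to integrals over the simplex.
  have h1 := hsol.eq_tau τ (extD j τ) (hτ.mono hU).isWeakD
  rw [ip_eq_of_subset hU σ fun x hx => hτ.eq_zero hx,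
    ip_eq_of_subset hU u fun x hx => hτ.extD_eq_zero hx] at h1
  rw [hw.2.2 τ hτ, ip_comm, ip_comm _ τ]
  linarith

/-- `f - dσ - p` is the weak codifferential of `du` on each simplex. -/
theorem HodgeLaplaceSolution.codiff_du (hsol : HodgeLaplaceSolution Ω f σ dσ u du p)
    (hf : MemL2 Ω f) (hT : IsTriangulation Ω T) {K : Finset (Euc n)} (hK : K ∈ T)
    {w : Form n (j + 1)} (hw : IsWeakCodiff (interior (cell K)) du w) :
    w =ᵐ[volume.restrict (interior (cell K))] f - dσ - p := by
  have hU := hT.interior_cell_subset hK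
  have mf := memL2_interior_cell.2 (hT.memL2_cell hK hf)
  have mσ := memL2_interior_cell.2 (hT.memL2_cell hK hsol.sigma_mem.2.1)
  have mp := memL2_interior_cell.2 (hT.memL2_cell hK hsol.p_mem.1.1)
  refine ae_eq_of_forall_isTest isOpen_interior hw.2.1 (MemLp.sub (MemLp.sub mf mσ) mp)
    fun v hv => ?_
  have mv := memL2_of_hasCompactSupport (interior (cell K)) hv.1.continuous hv.2.1
  have h1 := hsol.eq_v v (extD (j + 1) v) (hv.mono hU).isWeakD
  rw [ip_eq_of_subset hU dσ fun x hx => hv.eq_zero hx,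
    ip_eq_of_subset hU p fun x hx => hv.eq_zero hx,
    ip_eq_of_subset hU f fun x hx => hv.eq_zero hx,
    ip_eq_of_subset hU du fun x hx => hv.extD_eq_zero hx] at h1
  rw [hw.2.2 v hv, ip_comm, ip_comm _ v, ip_sub_left (MemLp.sub mf mσ) mp mv,
    ip_sub_left mf mσ mv]
  linarith

/-- The defining pairing of a projected normal trace, on a single simplex. -/
theorem IsNormalTraceProj.pairing {S : Submodule ℝ (Form n j)} {v : Form n (j + 1)}
    {Pv : BrokenTan n j} (hP : IsNormalTraceProj T S v Pv) {K : Finset (Euc n)} (hK : K ∈ T)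
    {w : Form n j} (hw : ∀ δ : Form n j, IsWeakCodiff (interior (cell K)) v δ →
      δ =ᵐ[volume.restrict (interior (cell K))] w) {τ : Form n j} (hτ : τ ∈ S) :
    bdIp K (Pv K) (tanTrace K j τ) = ip (cell K) (extD j τ) v - ip (cell K) τ w := by
  obtain ⟨-, δv, hδ, h⟩ := hP
  have h1 := h _ (memW_brokenSingle T K hτ)
  rw [bbdIp_brokenSingle hK, sum_traceDuality_brokenSingle hK] at h1
  rw [h1, traceDuality]
  congr 1
  have h2 := hw _ (hδ K hK)
  rw [restrict_interior_cell] at h2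
  refine integral_congr_ae ?_
  filter_upwards [h2] with x hx
  rw [hx]

end Exact

/-! ### Error equations for the two normal traces. -/

section Local

variable {Ω : Set (Euc n)} {T : Finset (Finset (Euc n))} {j m : ℕ} {f : Form n (j + 1)}
  {σ : Form n j} {dσ u : Form n (j + 1)} {du : Form n (j + 2)} {p : Form n (j + 1)}
  {S₀ : Submodule ℝ (Form n j)} {S₁ : Submodule ℝ (Form n (j + 1))}
  {σh : Broken n j} {uh pbar : Broken n (j + 1)}
  {unor : BrokenTan n j} {rhonor : BrokenTan n (j + 1)}
  {ph ubar : Broken n (j + 1)} {σtan : BrokenTan n j} {utan : BrokenTan n (j + 1)}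

/-- Subtracting the discrete equation from the pairing of the projected trace leaves (P_h u - u_h,
dτ)_K - (σ - σ_h, τ)_K, to which Cauchy–Schwarz applies. -/
theorem pairing_unor_le (hn : 0 < n) (hT : IsTriangulation Ω T)
    (hsol : HodgeLaplaceSolution Ω f σ dσ u du p)
    (hS₀ : S₀ ≤ polyForms n (m + 1) j) (hS₁ : S₁ ≤ polyForms n (m + 1) (j + 1))
    (hd : ∀ τ ∈ S₀, extD j τ ∈ S₁)
    (hsolh : HybridSolution Ω T S₀ S₁ f σh uh pbar unor rhonor ph ubar σtan utan)
    {Punor : BrokenTan n j} (hP : IsNormalTraceProj T S₀ u Punor)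
    {Pu : Broken n (j + 1)} (hPu : IsL2Proj T (fun _ => S₁) (fun _ => u) Pu)
    {K : Finset (Euc n)} (hK : K ∈ T) {τ : Form n j} (hτ : τ ∈ S₀) :
    bdIp K (Punor K - unor K) (tanTrace K j τ) ≤
      nrm (cell K) (extD j τ) * nrm (cell K) (Pu K - uh K) +
        nrm (cell K) τ * nrm (cell K) (σ - σh K) := by
  have mS : ∀ {i : ℕ} {S : Submodule ℝ (Form n i)}, S ≤ polyForms n (m + 1) i → ∀ {η : Form n i},
      η ∈ S → MemL2 (cell K) η := fun hS _ hη =>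
    memL2_cell_of_continuous K (contDiff_of_mem_polyForms (hS hη)).continuous
  have mτ := mS hS₀ hτ
  have mdτ := mS hS₁ (hd τ hτ)
  have mu := hT.memL2_cell hK hsol.u_mem.1
  have mσ := hT.memL2_cell hK hsol.sigma_mem.1
  have mσh := mS hS₀ (hsolh.sigma_mem K hK)
  have muh := mS hS₁ (hsolh.u_mem K hK)
  have mPu := mS hS₁ (hPu K hK).1
  have h1 := hP.pairing hK (fun δ hδ => hsol.codiff_u hT hK hδ) hτ
  have h2 := hsolh.eq_tau _ (memW_brokenSingle T K hτ)
  rw [bD_brokenSingle, bip_brokenSingle hK, bip_brokenSingle hK, bbdIp_brokenSingle hK] at h2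
  -- Since dτ lies in the upper local space, u may be exchanged for its projection.
  have h3 := (hPu K hK).2 _ (hd τ hτ)
  rw [ip_sub_left mu mPu mdτ] at h3
  have h4 := abs_ip_le mdτ (MemLp.sub mPu muh : MemL2 (cell K) (Pu K - uh K))
  have h5 := abs_ip_le mτ (MemLp.sub mσ mσh : MemL2 (cell K) (σ - σh K))
  rw [ip_comm, ip_sub_left mPu muh mdτ] at h4
  rw [ip_comm, ip_sub_left mσ mσh mτ] at h5
  rw [(hT.isSimplex hK).bdIp_sub_left hn hS₀ (hP.1 K hK) (hsolh.unor_mem K hK) hτ, h1,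
    ip_comm _ _ u, ip_comm _ τ]
  linarith [le_abs_self (ip (cell K) (Pu K) (extD j τ) - ip (cell K) (uh K) (extD j τ)),
    neg_abs_le (ip (cell K) σ τ - ip (cell K) (σh K) τ)]

/-- The data f cancels between δρ = f - dσ - p and the discrete equation, leaving (P_h d(u - u_h),
dv)_K + (dσ - dσ_h, v)_K + (p - p_h, v)_K. -/
theorem pairing_rhonor_le (hn : 0 < n) (hT : IsTriangulation Ω T) (hf : MemL2 Ω f)
    (hsol : HodgeLaplaceSolution Ω f σ dσ u du p)
    (hS₀ : S₀ ≤ polyForms n (m + 1) j) (hS₁ : S₁ ≤ polyForms n (m + 1) (j + 1))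
    (hsolh : HybridSolution Ω T S₀ S₁ f σh uh pbar unor rhonor ph ubar σtan utan)
    {Prhonor : BrokenTan n (j + 1)} (hP : IsNormalTraceProj T S₁ du Prhonor)
    {S₂ : Finset (Euc n) → Submodule ℝ (Form n (j + 2))} (hS₂ : ContinuesComplex T S₁ S₂)
    {Pde : Broken n (j + 2)} (hPde : IsL2Proj T S₂ (fun K => du - bD uh K) Pde)
    {K : Finset (Euc n)} (hK : K ∈ T) {v : Form n (j + 1)} (hv : v ∈ S₁) :
    bdIp K (Prhonor K - rhonor K) (tanTrace K (j + 1) v) ≤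
      nrm (cell K) (extD (j + 1) v) * nrm (cell K) (Pde K) +
        nrm (cell K) v * (nrm (cell K) (dσ - bD σh K) + nrm (cell K) (p - ph K)) := by
  have mS : ∀ {η : Form n (j + 1)}, η ∈ S₁ → MemL2 (cell K) η := fun hη =>
    memL2_cell_of_continuous K (contDiff_of_mem_polyForms (hS₁ hη)).continuous
  have mdS : ∀ {i : ℕ} {S : Submodule ℝ (Form n i)}, S ≤ polyForms n (m + 1) i → ∀ {η : Form n i},
      η ∈ S → MemL2 (cell K) (extD i η) := fun hS _ hη =>
    memL2_cell_of_continuous K (contDiff_of_mem_polyForms (extD_mem_polyForms (hS hη))).continuous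
  have mv := mS hv
  have mdv := mdS hS₁ hv
  have mf := hT.memL2_cell hK hf
  have mdσ := hT.memL2_cell hK hsol.sigma_mem.2.1
  have mdu := hT.memL2_cell hK hsol.u_mem.2.1
  have mp := hT.memL2_cell hK hsol.p_mem.1.1
  have mdσh : MemL2 (cell K) (bD σh K) := mdS hS₀ (hsolh.sigma_mem K hK)
  have mduh : MemL2 (cell K) (bD uh K) := mdS hS₁ (hsolh.u_mem K hK)
  have mph := mS (hsolh.p_mem.1.1 K hK)
  have mpb := mS (hsolh.pbar_mem K hK).1
  have mPde : MemL2 (cell K) (Pde K) := by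
    obtain ⟨dw, hdw⟩ := (hS₂ K hK).2.2 _ (hPde K hK).1
    exact memL2_interior_cell.1 hdw.1
  -- The multiplier p̄_h is an admissible test form in its own orthogonality condition, so its norm
  -- vanishes on every simplex.
  have hpb : ip (cell K) (pbar K) v = 0 := by
    have h0 := hsolh.eq_vbar _ hsolh.pbar_mem
    have h1 := (Finset.sum_eq_zero_iff_of_nonneg fun L _ => ip_self_nonneg (cell L) (pbar L)).1 h0
      K hK
    have h2 := abs_ip_le mpb mv
    rw [nrm, h1, Real.sqrt_zero, zero_mul] at h2
    exact abs_nonpos_iff.1 h2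
  have h1 := hP.pairing hK (fun δ hδ => hsol.codiff_du hf hT hK hδ) hv
  have h2 := hsolh.eq_v _ (memW_brokenSingle T K hv)
  rw [bD_brokenSingle, bip_brokenSingle hK, bip_brokenSingle hK, bip_brokenSingle hK,
    bip_brokenSingle hK, bbdIp_brokenSingle hK, Pi.add_apply, ip_add_left mpb mph mv, hpb] at h2
  have h3 := (hPde K hK).2 _ ((hS₂ K hK).2.1 v hv)
  rw [ip_sub_left (MemLp.sub mdu mduh) mPde mdv, ip_sub_left mdu mduh mdv] at h3
  have h4 := abs_ip_le mPde mdv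
  have h5 := abs_ip_le (MemLp.sub mdσ mdσh : MemL2 (cell K) (dσ - bD σh K)) mv
  have h6 := abs_ip_le (MemLp.sub mp mph : MemL2 (cell K) (p - ph K)) mv
  rw [ip_sub_left mdσ mdσh mv] at h5
  rw [ip_sub_left mp mph mv] at h6
  rw [(hT.isSimplex hK).bdIp_sub_left hn hS₁ (hP.1 K hK) (hsolh.rhonor_mem K hK) hv, h1,
    ip_comm _ _ du, ip_comm _ v, ip_sub_left (MemLp.sub mf mdσ) mp mv, ip_sub_left mf mdσ mv]
  have h4' := le_of_abs_le h4
  have h5' := le_of_abs_le h5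
  have h6' := le_of_abs_le h6
  linarith

end Local

/-! ### Summation over the mesh. -/

theorem cellDiam_le_meshSize {T : Finset (Finset (Euc n))} {K : Finset (Euc n)} (hK : K ∈ T) :
    cellDiam K ≤ meshSize T :=
  le_ciSup (f := fun K : {K // K ∈ T} => cellDiam K.1) (Set.finite_range _).bddAbove ⟨K, hK⟩

theorem bnrm_sq {j : ℕ} (T : Finset (Finset (Euc n))) (α : Broken n j) :
    bnrm T α ^ 2 = ∑ K ∈ T, nrm (cell K) (α K) ^ 2 := by
  rw [bnrm, bip, Real.sq_sqrt (Finset.sum_nonneg fun K _ => ip_self_nonneg _ _)]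
  simp only [nrm_sq]

/-- Summation of local estimates. -/
theorem bTriNorm_le {i j : ℕ} {l l' : ℕ} {T : Finset (Finset (Euc n))} {s : BrokenTan n i}
    {C : ℝ} (hC : 0 ≤ C) (a : Broken n j) (b : Broken n l) (c : Broken n l')
    (h : ∀ K ∈ T, triNorm K (s K) ≤ C * (nrm (cell K) (a K) +
      cellDiam K * (nrm (cell K) (b K) + nrm (cell K) (c K)))) :
    bTriNorm T s ≤ 2 * C * (bnrm T a + meshSize T * (bnrm T b + bnrm T c)) := by
  have hm : 0 ≤ meshSize T := Real.iSup_nonneg fun K => cellDiam_nonneg K.1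
  have ha : 0 ≤ bnrm T a := Real.sqrt_nonneg _
  have hb : 0 ≤ bnrm T b := Real.sqrt_nonneg _
  have hc : 0 ≤ bnrm T c := Real.sqrt_nonneg _
  rw [bTriNorm]
  refine Real.sqrt_le_iff.2 ⟨by positivity, ?_⟩
  -- The square of a sum of three terms is at most 3 times the sum of squares; bounding 3 by 4 = 2²
  -- accounts for the factor 2 in the conclusion.
  calc ∑ K ∈ T, triNorm K (s K) ^ 2 ≤ ∑ K ∈ T, C ^ 2 * (3 * (nrm (cell K) (a K) ^ 2 +
        meshSize T ^ 2 * (nrm (cell K) (b K) ^ 2 + nrm (cell K) (c K) ^ 2))) := by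
        refine Finset.sum_le_sum fun K hK => ?_
        have h1 := h K hK
        have h2 := cellDiam_le_meshSize hK
        have na := nrm_nonneg (cell K) (a K)
        have nb := nrm_nonneg (cell K) (b K)
        have nc := nrm_nonneg (cell K) (c K)
        have h3 : triNorm K (s K) ≤ C * (nrm (cell K) (a K) +
            meshSize T * (nrm (cell K) (b K) + nrm (cell K) (c K))) := by
          refine h1.trans ?_
          gcongr
        refine (pow_le_pow_left₀ (triNorm_nonneg _ _) h3 2).trans ?_
        rw [mul_pow]
        gcongr
        nlinarith [sq_nonneg (nrm (cell K) (a K) - meshSize T * nrm (cell K) (b K)),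
          sq_nonneg (nrm (cell K) (a K) - meshSize T * nrm (cell K) (c K)),
          sq_nonneg (meshSize T * nrm (cell K) (b K) - meshSize T * nrm (cell K) (c K))]
    _ = C ^ 2 * (3 * (bnrm T a ^ 2 + meshSize T ^ 2 * (bnrm T b ^ 2 + bnrm T c ^ 2))) := by
        rw [bnrm_sq, bnrm_sq, bnrm_sq, ← Finset.mul_sum, ← Finset.mul_sum,
          Finset.sum_add_distrib, ← Finset.mul_sum, Finset.sum_add_distrib]
    _ ≤ C ^ 2 * (4 * (bnrm T a + meshSize T * (bnrm T b + bnrm T c)) ^ 2) := by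
        refine mul_le_mul_of_nonneg_left ?_ (sq_nonneg C)
        have e1 : 0 ≤ meshSize T * bnrm T b := by positivity
        have e2 : 0 ≤ meshSize T * bnrm T c := by positivity
        nlinarith [mul_nonneg ha e1, mul_nonneg ha e2, mul_nonneg e1 e2, sq_nonneg (bnrm T a),
          sq_nonneg (meshSize T * bnrm T b), sq_nonneg (meshSize T * bnrm T c)]
    _ = _ := by ring

end HybridFEEC
end

/-! ### The main estimates. -/

open HybridFEEC
theorem mainTheorem7 (n k r : ℕ) (hn : 0 < n) (hk : k ≤ n) (κ₀ κ₁ : Kind)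
    (hr : κ₁ = Kind.full → 1 ≤ r) (γ : ℝ) (hγ : 0 < γ) :
    ∃ C : ℝ, 0 < C ∧
      ∀ (Ω : Set (Euc n)) (T : Finset (Finset (Euc n))),
        IsTriangulation Ω T → ShapeRegular γ T →
      ∀ f : Form n (k + 1), MemL2 Ω f →
      -- the exact solution
      ∀ (σ : Form n k) (dσ u : Form n (k + 1)) (du : Form n (k + 2)) (p : Form n (k + 1)),
        HodgeLaplaceSolution Ω f σ dσ u du p →
      -- the solution of the hybridized method
      ∀ (σh : Broken n k) (uh pbar : Broken n (k + 1))
        (unor : BrokenTan n k) (rhonor : BrokenTan n (k + 1))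
        (ph ubar : Broken n (k + 1)) (σtan : BrokenTan n k) (utan : BrokenTan n (k + 1)),
        HybridSolution Ω T (lowSpace n r k κ₀) (highSpace n r (k + 1) κ₁) f
          σh uh pbar unor rhonor ph ubar σtan utan →
      -- the projected normal traces of `u` and `ρ = du`
      ∀ (Punor : BrokenTan n k) (Prhonor : BrokenTan n (k + 1)),
        IsNormalTraceProj T (lowSpace n r k κ₀) u Punor →
        IsNormalTraceProj T (highSpace n r (k + 1) κ₁) du Prhonor →
      -- the elementwise `L²` projections of `u` and of `d (u - u_h)`
      ∀ (S₂ : Finset (Euc n) → Submodule ℝ (Form n (k + 2))),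
        ContinuesComplex T (highSpace n r (k + 1) κ₁) S₂ →
      ∀ (Pu : Broken n (k + 1)) (Pde : Broken n (k + 2)),
        IsL2Proj T (fun _ => highSpace n r (k + 1) κ₁) (fun _ => u) Pu →
        IsL2Proj T S₂ (fun K => du - bD uh K) Pde →
      (∀ K ∈ T,
        triNorm K (Punor K - unor K)
          ≤ C * (nrm (cell K) (Pu K - uh K)
              + cellDiam K * nrm (cell K) (σ - σh K))) ∧
      (∀ K ∈ T,
        triNorm K (Prhonor K - rhonor K)
          ≤ C * (nrm (cell K) (Pde K)
              + cellDiam K * (nrm (cell K) (dσ - bD σh K) + nrm (cell K) (p - ph K)))) ∧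
      (bTriNorm T (Punor - unor)
          ≤ C * (bnrm T (Pu - uh) + meshSize T * bnrm T (fun K => σ - σh K))) ∧
      (bTriNorm T (Prhonor - rhonor)
          ≤ C * (bnrm T Pde
              + meshSize T * (bnrm T (fun K => dσ - bD σh K) + bnrm T (fun K => p - ph K)))) := by
  -- The lifting constants are fixed before the mesh and the solutions are introduced, so they
  -- depend only on n, k, r, γ and the families.
  obtain ⟨C₁, hC₁, hlift₁⟩ := exists_uniform_lift hn (lowSpace n r k κ₀) (lowSpace_le r k κ₀)
    (fun A b _ hv => pullForm_mem_lowSpace A b κ₀ hv) hγ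
  obtain ⟨C₂, hC₂, hlift₂⟩ := exists_uniform_lift hn (highSpace n r (k + 1) κ₁)
    (highSpace_le r (k + 1) κ₁) (fun A b _ hv => pullForm_mem_highSpace A b κ₁ hv) hγ
  -- The factor 2 is the one lost in summation; the sum covers both traces.
  refine ⟨2 * (C₁ + C₂), by positivity, ?_⟩
  intro Ω T hT hreg f hf σ dσ u du p hsol σh uh pbar unor rhonor ph ubar σtan utan hsolh
    Punor Prhonor hPu hPr S₂ hS₂ Pu Pde hproj hproj₂
  have loc₁ : ∀ K ∈ T, triNorm K (Punor K - unor K) ≤ C₁ * (nrm (cell K) (Pu K - uh K) +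
      cellDiam K * nrm (cell K) (σ - σh K)) := fun K hK =>
    triNorm_le_of_pairing hC₁.le (hlift₁ K (hT.isSimplex hK) (hreg K hK) _
      (sub_mem (hPu.1 K hK) (hsolh.unor_mem K hK))) (nrm_nonneg _ _) (nrm_nonneg _ _)
      fun τ hτ => pairing_unor_le hn hT hsol (lowSpace_le r k κ₀) (highSpace_le r (k + 1) κ₁)
        (fun _ hτ => extD_mem_highSpace κ₁ hτ) hsolh hPu hproj hK hτ
  have loc₂ : ∀ K ∈ T, triNorm K (Prhonor K - rhonor K) ≤ C₂ * (nrm (cell K) (Pde K) +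
      cellDiam K * (nrm (cell K) (dσ - bD σh K) + nrm (cell K) (p - ph K))) := fun K hK =>
    triNorm_le_of_pairing hC₂.le (hlift₂ K (hT.isSimplex hK) (hreg K hK) _
      (sub_mem (hPr.1 K hK) (hsolh.rhonor_mem K hK))) (nrm_nonneg _ _)
      (add_nonneg (nrm_nonneg _ _) (nrm_nonneg _ _))
      fun v hv => pairing_rhonor_le hn hT hf hsol (lowSpace_le r k κ₀)
        (highSpace_le r (k + 1) κ₁) hsolh hPr hS₂ hproj₂ hK hv
  have hm : 0 ≤ meshSize T := Real.iSup_nonneg fun K => cellDiam_nonneg K.1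
  have hb : ∀ {i : ℕ} (w : Broken n i), 0 ≤ bnrm T w := fun w => Real.sqrt_nonneg _
  refine ⟨fun K hK => (loc₁ K hK).trans ?_, fun K hK => (loc₂ K hK).trans ?_, ?_, ?_⟩
  · have := nrm_nonneg (cell K) (Pu K - uh K)
    have := nrm_nonneg (cell K) (σ - σh K)
    have := cellDiam_nonneg K
    gcongr
    linarith
  · have := nrm_nonneg (cell K) (Pde K)
    have := nrm_nonneg (cell K) (dσ - bD σh K)
    have := nrm_nonneg (cell K) (p - ph K)
    have := cellDiam_nonneg K
    gcongr
    linarith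
  -- This estimate has no third error term, so the zero (-1)-form fills that slot.
  · have h := bTriNorm_le (s := Punor - unor) hC₁.le (Pu - uh) (fun K => σ - σh K)
      (0 : Broken n 0) fun K hK => by
        have h0 : nrm (cell K) ((0 : Broken n 0) K) = 0 := by simp [nrm]
        rw [h0, add_zero]
        exact loc₁ K hK
    have h0 : bnrm T (0 : Broken n 0) = 0 := by simp [bnrm, bip]
    rw [h0, add_zero] at h
    refine h.trans ?_
    have := hb (Pu - uh)
    have := hb fun K => σ - σh K
    gcongr
    linarith
  · refine (bTriNorm_le (s := Prhonor - rhonor) hC₂.le Pde (fun K => dσ - bD σh K)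
      (fun K => p - ph K) loc₂).trans ?_
    have := hb Pde
    have := hb fun K => dσ - bD σh K
    have := hb fun K => p - ph K
    gcongr
    linarith
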